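/- Let $V:\mathbb R\to\mathbb R$ be continuous with period $1$, and let $\psi(x,t)=e^{-i\omega(\epsilon)t}\phi(x,\epsilon)$, $|\epsilon|<\delta$, be a $C^2$ family of standing wave solutions of $$i\psi_t=-\tfrac12\psi_{xx}+\epsilon|\psi|^2\psi+V(x)\psi ,$$ where $\phi$ is real valued, $C^2$ in $(x,\epsilon)$, and either $\phi(x+1,\epsilon)=\phi(x,\epsilon)$ for all $x,\epsilon$ or $\phi(x+1,\epsilon)=-\phi(x,\epsilon)$ for all $x,\epsilon$; $\omega$ is $C^2$; and $\phi(\cdot,0)\not\equiv0$. Put $$L_-=-\tfrac12\partial_{xx}+V+\epsilon\phi^2-\omega(\epsilon),\qquad L_+=-\tfrac12\partial_{xx}+V+3\epsilon\phi^2-\omega(\epsilon).$$ The stability problem is $L_+p=\mu q$, $L_-q=\mu p$; its spectrum is the set of $\mu\in\mathbb C$ for which it has a nonzero solution with $(p,q)(x+1)=z\,(p,q)(x)$ for all $x$ and some $|z|=1$. For real $\mu$ let $M(\mu,\epsilon)$ be the $4\times4$ monodromy (period) matrix of this problem, written as a first-order system, and let $$D(\mu,\epsilon)=2\operatorname{Tr}(M^2)-(\operatorname{Tr}M)^2+8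 .$$ Thus $D=(K_+-K_-)^2$, where $\det(M-\lambda I)=(1-K_+\lambda+\lambda^2)(1-K_-\lambda+\lambda^2)$. Let $k(\mu)$ be the Floquet discriminant (trace of the $2\times 2$ monodromy matrix) of $-\tfrac12f''+(V-\omega(0))f=\mu f$. Let $\mu^*\in\mathbb R$ satisfy $k(\mu^*)=k(-\mu^*)\in(-2,2)$. Put $s=k'(\mu^*)+k'(-\mu^*)$, let $\beta=\partial_\epsilon\partial_\mu D(\mu^*,0)$ and $\gamma_0=\tfrac12\partial_\epsilon^2D(\mu^*,0)$ be the coefficients of $\epsilon(\mu-\mu^*)$ and of $\epsilon^2$ in the second-order Taylor polynomial $s^2(\mu-\mu^*)^2+\beta\epsilon(\mu-\mu^*)+\gamma_0\epsilon^2$ of $D$ at $(\mu^*,0)$, and let $\gamma$ be the coefficient of $\epsilon^2$ after completing the square in $\mu-\mu^*$: $\gamma=\gamma_0-\beta^2/(4s^2)$ if $s\ne0$, and $\gamma=\gamma_0$ if $s=0$. (So $\gamma=\gamma_0$ whenever $\beta=0$.) Suppose that either $\operatorname{sgn}k'(\mu^*)=\operatorname{sgn}k'(-\mu^*)$ and $\gamma>0$,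 or $\operatorname{sgn}k'(\mu^*)=-\operatorname{sgn}k'(-\mu^*)$ and $\gamma<0$. Then for every $r>0$ there is $\epsilon_0\in(0,\delta]$ such that for all $\epsilon$ with $0<|\epsilon|<\epsilon_0$ there is a band of spectrum off the real axis near $\mu^*$: the spectrum of the stability problem contains a nondegenerate (injective, continuous) arc that lies in $\{\operatorname{Im}\mu\neq0,\ |\mu-\mu^*|<r\}$. -/

import Mathlib

open Set

namespace SidebandNLS

/-- `ψ` (as a function of `x`, then `t`) solves
`i ψ_t = -(1/2) ψ_xx + ε |ψ|² ψ + V ψ`. -/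
def IsNLSSolution (V : ℝ → ℝ) (ε : ℝ) (ψ : ℝ → ℝ → ℂ) : Prop :=
  ∀ x t : ℝ, Complex.I * deriv (fun τ => ψ x τ) t =
    -(1 / 2) * deriv (deriv fun y => ψ y t) x + (ε : ℂ) * (‖ψ x t‖ : ℂ) ^ 2 * ψ x t
      + (V x : ℂ) * ψ x t

/-- A `C²` family `ψ = exp (-i ω(ε) t) φ(x, ε)`, `|ε| < δ`, of standing waves with a real profile
that is periodic or antiperiodic with period `1`, bifurcating from an eigenfunction `φ(·, 0)` of the
linear periodic Schrödinger operator. -/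
structure IsStandingWaveFamily (V : ℝ → ℝ) (φ : ℝ → ℝ → ℝ) (ω : ℝ → ℝ) (δ : ℝ) : Prop where
  delta_pos : 0 < δ
  contDiff_profile : ContDiffOn ℝ 2 (fun z : ℝ × ℝ => φ z.1 z.2) (univ ×ˢ Ioo (-δ) δ)
  contDiff_frequency : ContDiffOn ℝ 2 ω (Ioo (-δ) δ)
  periodic_or_antiperiodic :
    (∀ ε ∈ Ioo (-δ) δ, ∀ x, φ (x + 1) ε = φ x ε) ∨
      (∀ ε ∈ Ioo (-δ) δ, ∀ x, φ (x + 1) ε = -φ x ε)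
  solves : ∀ ε ∈ Ioo (-δ) δ,
    IsNLSSolution V ε fun x t => Complex.exp (-Complex.I * (ω ε : ℂ) * (t : ℂ)) * (φ x ε : ℂ)
  nontrivial : ∃ x, φ x 0 ≠ 0

/-- The potential in `L₋ = -(1/2) ∂ₓₓ + V + ε φ² - ω`. -/
def potMinus (V : ℝ → ℝ) (φ : ℝ → ℝ → ℝ) (ω : ℝ → ℝ) (ε x : ℝ) : ℝ :=
  V x + ε * φ x ε ^ 2 - ω ε

/-- The potential in `L₊ = -(1/2) ∂ₓₓ + V + 3 ε φ² - ω`. -/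
def potPlus (V : ℝ → ℝ) (φ : ℝ → ℝ → ℝ) (ω : ℝ → ℝ) (ε x : ℝ) : ℝ :=
  V x + 3 * ε * φ x ε ^ 2 - ω ε

/-- The Schrödinger operator `f ↦ -(1/2) f'' + W f`. -/
noncomputable def schrodinger (W : ℝ → ℝ) (f : ℝ → ℂ) (x : ℝ) : ℂ :=
  -(1 / 2) * deriv (deriv f) x + (W x : ℂ) * f x

/-- The Floquet spectrum of the linearized stability problem `L₊ p = μ q`, `L₋ q = μ p`: those
complex `μ` for which it has a nonzero solution with a Floquet multiplier `z` on the unit circle. -/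
def stabilitySpectrum (V : ℝ → ℝ) (φ : ℝ → ℝ → ℝ) (ω : ℝ → ℝ) (ε : ℝ) : Set ℂ :=
  {μ | ∃ (p q : ℝ → ℂ) (z : ℂ), ContDiff ℝ 2 p ∧ ContDiff ℝ 2 q ∧ (p ≠ 0 ∨ q ≠ 0) ∧ ‖z‖ = 1 ∧
    (∀ x, p (x + 1) = z * p x ∧ q (x + 1) = z * q x) ∧
    ∀ x, schrodinger (potPlus V φ ω ε) p x = μ * q x ∧
      schrodinger (potMinus V φ ω ε) q x = μ * p x}

/-- `U` is the solution operator of `y' = A(x) y`: `U' = A U`, `U(0) = 1`. -/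
def IsSolutionOperator {n : ℕ} (A U : ℝ → Matrix (Fin n) (Fin n) ℝ) : Prop :=
  U 0 = 1 ∧ ∀ x i j, HasDerivAt (fun s => U s i j) ((A x * U x) i j) x

open Classical in
/-- The monodromy matrix `U(1)` of `y' = A(x) y`. The solution operator exists and is unique for
continuous `A`; the other branch is never used for such `A`. -/
noncomputable def monodromy {n : ℕ} (A : ℝ → Matrix (Fin n) (Fin n) ℝ) :
    Matrix (Fin n) (Fin n) ℝ :=
  if h : ∃ U, IsSolutionOperator A U then h.choose 1 else 1

/-- The equation `-(1/2) f'' + W f = μ f` as a first order system for `(f, f')`. -/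
def hillSystem (W : ℝ → ℝ) (μ x : ℝ) : Matrix (Fin 2) (Fin 2) ℝ :=
  !![0, 1;
     2 * (W x - μ), 0]

/-- The Floquet discriminant `k(μ) = Tr m(μ)` of the operator `L₋` at `ε = 0`. -/
noncomputable def hillDiscriminant (V : ℝ → ℝ) (φ : ℝ → ℝ → ℝ) (ω : ℝ → ℝ) (μ : ℝ) : ℝ :=
  (monodromy (hillSystem (potMinus V φ ω 0) μ)).trace

/-- The stability problem `L₊ p = μ q`, `L₋ q = μ p` as a first order system for
`(p, p', q, q')`. -/
def stabilitySystem (V : ℝ → ℝ) (φ : ℝ → ℝ → ℝ) (ω : ℝ → ℝ) (μ ε x : ℝ) :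
    Matrix (Fin 4) (Fin 4) ℝ :=
  !![0, 1, 0, 0;
     2 * potPlus V φ ω ε x, 0, -2 * μ, 0;
     0, 0, 0, 1;
     -2 * μ, 0, 2 * potMinus V φ ω ε x, 0]

/-- The monodromy matrix `M(μ, ε)` of the stability problem, for real `μ`. -/
noncomputable def stabilityMonodromy (V : ℝ → ℝ) (φ : ℝ → ℝ → ℝ) (ω : ℝ → ℝ) (μ ε : ℝ) :
    Matrix (Fin 4) (Fin 4) ℝ :=
  monodromy (stabilitySystem V φ ω μ ε)

/-- The radicand `D = a² - 4 b + 8 = 2 Tr M² - (Tr M)² + 8 = (K₊ - K₋)²`, where the characteristic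
polynomial of `M` is `1 + a λ + b λ² + a λ³ + λ⁴ = (1 - K₊ λ + λ²) (1 - K₋ λ + λ²)`. -/
noncomputable def radicand (V : ℝ → ℝ) (φ : ℝ → ℝ → ℝ) (ω : ℝ → ℝ) (μ ε : ℝ) : ℝ :=
  2 * (stabilityMonodromy V φ ω μ ε ^ 2).trace - (stabilityMonodromy V φ ω μ ε).trace ^ 2 + 8

/-- `s = k'(μ*) + k'(-μ*)`. -/
noncomputable def slopeSum (V : ℝ → ℝ) (φ : ℝ → ℝ → ℝ) (ω : ℝ → ℝ) (μs : ℝ) : ℝ :=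
  deriv (hillDiscriminant V φ ω) μs + deriv (hillDiscriminant V φ ω) (-μs)

/-- The coefficient `β` of `ε (μ - μ*)` in the second order Taylor polynomial
`s² (μ - μ*)² + β ε (μ - μ*) + γ₀ ε²` of the radicand at `(μ*, 0)`. -/
noncomputable def mixedCoeff (V : ℝ → ℝ) (φ : ℝ → ℝ → ℝ) (ω : ℝ → ℝ) (μs : ℝ) : ℝ :=
  deriv (fun ε => deriv (fun μ => radicand V φ ω μ ε) μs) 0

/-- The coefficient `γ₀` of `ε²` in the same Taylor polynomial. -/
noncomputable def epsSqCoeff (V : ℝ → ℝ) (φ : ℝ → ℝ → ℝ) (ω : ℝ → ℝ) (μs : ℝ) : ℝ :=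
  deriv (deriv fun ε => radicand V φ ω μs ε) 0 / 2

open Classical in
/-- The coefficient `γ` in the normal form `s² (μ - μ* + c ε)² + γ ε²` of the radicand, in which the
mixed term is removed by completing the square. It is `γ₀` if `β = 0`; in the case `s = 0` there is
no square to complete. -/
noncomputable def normalFormGamma (V : ℝ → ℝ) (φ : ℝ → ℝ → ℝ) (ω : ℝ → ℝ) (μs : ℝ) : ℝ :=
  if slopeSum V φ ω μs = 0 then epsSqCoeff V φ ω μs
  else epsSqCoeff V φ ω μs - mixedCoeff V φ ω μs ^ 2 / (4 * slopeSum V φ ω μs ^ 2)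

/-- A set of complex numbers contains a band (a nondegenerate continuous arc) lying off the real
axis and within distance `r` of `z₀`. -/
def HasBandOffRealAxis (S : Set ℂ) (z₀ : ℂ) (r : ℝ) : Prop :=
  ∃ c : ℝ → ℂ, ContinuousOn c (Icc 0 1) ∧ InjOn c (Icc 0 1) ∧
    ∀ t ∈ Icc (0 : ℝ) 1, c t ∈ S ∧ (c t).im ≠ 0 ∧ ‖c t - z₀‖ < r

end SidebandNLS

/-!
Let `M(μ, ε)` be the monodromy matrix of the stability problem for complex `μ`. It is symplectic, so
`M + M⁻¹` has two double eigenvalues `K₊`, `K₋`, and its trace-free part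
`Z = M + M⁻¹ - (Tr M) / 2` (`splitting`) satisfies `Z² = D / 4`, where `D = (K₊ - K₋)² = Tr Z²` is
the radicand. If a real `K ∈ (-2, 2)` solves `(2 K - Tr M)² = D`, then `K = z + z⁻¹` for a Floquet
multiplier `z` with `|z| = 1`, and `μ` is in the spectrum (`exists_multiplier`,
`mem_stabilitySpectrum_of_discriminant`). A band off the real axis is therefore a curve of nonreal
`μ` parametrized by real `K` and solving this equation.

At `ε = 0` the functions `p ± q` satisfy Hill's equation with the parameters `±μ`
(`isFundamental_sumDiff`). Hence `Tr M = k(μ) + k(-μ)`, while `Z` is `(k(μ) - k(-μ)) / 2` times the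
exchange of `p` and `q`, which vanishes at `μ*`. Because `Z` vanishes at `(μ*, 0)`, the second order
Taylor polynomial of `D = Tr Z²` there is determined by the first derivatives of `Z`
(`mixedCoeff_eq`, `epsSqCoeff_eq`), so `C¹` dependence of `M` on the parameters suffices. That
dependence comes from writing the fundamental solution as `(1 - T a)⁻¹ 1`, with `T a` the Volterra
operator of the coefficient `a` (`contDiff_propagator`).

With `μ = μ* + ε m` and `2 K = 2 k(μ*) + ε (κ + σ)`, where `σ = ∂_ε Tr M`, the equation for `m`
becomes, as `ε → 0`, the real quadratic `(κ - S₁ m)² = s² m² + β m + γ₀`, where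
`S₁ = k'(μ*) - k'(-μ*)`. For the best choice of `κ` its discriminant is `-16 k'(μ*) k'(-μ*) γ` if
`s ≠ 0`, and it can be made negative in the same way if `s = 0` (`exists_discriminant_neg`). The
hypothesis on the signs says exactly that `k'(μ*) k'(-μ*) γ > 0`, because `k'` does not vanish
inside the bands of Hill's equation (`hill_discriminant_deriv`). So the quadratic has a simple
nonreal root `m`, which persists for small `ε` and for `κ` in an interval by an inverse function
theorem for the rescaled equation (`exists_scaled_inverse`, `exists_nonreal_arc`). Finally, a point
`μ` of the arc comes from at most two values `K`, with sum `Tr M`, so `K ↦ μ` is injective on a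
subinterval (`exists_injOn_subarc`).
-/

open MeasureTheory Filter Topology

namespace SidebandNLS

/-! ### Fixed points of affine maps depending on a parameter -/

section Resolvent

variable {A E : Type*} [NormedAddCommGroup A] [NormedSpace ℂ A]
  [NormedAddCommGroup E] [NormedSpace ℂ E]

/-- Implicit differentiation of the equation `f(a) = e + T(a) f(a)`. -/
theorem fderiv_apply_of_forall_eq_add {f : A → E} (hf : Differentiable ℂ f)
    (T : A →L[ℂ] E →L[ℂ] E) (e : E) (h : ∀ a, f a = e + T a (f a)) (a b : A) :
    fderiv ℂ f a b = T b (f a) + T a (fderiv ℂ f a b) := by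
  have h1 : HasFDerivAt f (fderiv ℂ f a) a := (hf a).hasFDerivAt
  have h2 := ((T.hasFDerivAt (x := a)).clm_apply h1).const_add e
  have h3 := h2.congr_of_eventuallyEq (Eventually.of_forall h)
  have := congrArg (fun T => T b) (h1.unique h3)
  simpa [add_comm] using this

variable [CompleteSpace E]

theorem isUnit_one_sub_of_norm_pow_lt_one {T : E →L[ℂ] E} {n : ℕ} (h : ‖T ^ n‖ < 1) :
    IsUnit (1 - T) := by
  have hunit : IsUnit (1 - T ^ n) := isUnit_one_sub_of_norm_lt_one h
  rw [← mul_neg_geom_sum] at hunit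
  have hc : Commute (1 - T) (∑ i ∈ Finset.range n, T ^ i) := by
    rw [commute_iff_eq, mul_neg_geom_sum, geom_sum_mul_neg]
  exact ((hc.isUnit_mul_iff).1 hunit).1

/-- The solution `f` of `f = e + T a f`, as a function of the parameter `a`. -/
noncomputable def fixedPoint (T : A →L[ℂ] E →L[ℂ] E) (e : E) (a : A) : E :=
  Ring.inverse (1 - T a) e

omit [CompleteSpace E] in
theorem fixedPoint_eq {T : A →L[ℂ] E →L[ℂ] E} (hT : ∀ a, IsUnit (1 - T a)) (e : E) (a : A) :
    fixedPoint T e a = e + T a (fixedPoint T e a) := by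
  have h := congrArg (fun S => S e) (Ring.mul_inverse_cancel _ (hT a))
  simp only [mul_apply_eq_comp, sub_apply, one_apply_eq_self] at h
  exact sub_eq_iff_eq_add.1 h

omit [CompleteSpace E] in
theorem eq_fixedPoint {T : A →L[ℂ] E →L[ℂ] E} (hT : ∀ a, IsUnit (1 - T a)) {e f : E} {a : A}
    (hf : f = e + T a f) : f = fixedPoint T e a := by
  have h := congrArg (fun S => S f) (Ring.inverse_mul_cancel _ (hT a))
  simp only [mul_apply_eq_comp, sub_apply, one_apply_eq_self] at h
  rw [sub_eq_iff_eq_add.2 hf] at h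
  exact h.symm

theorem contDiff_fixedPoint {T : A →L[ℂ] E →L[ℂ] E} (hT : ∀ a, IsUnit (1 - T a))
    (e : E) : ContDiff ℂ 1 (fixedPoint T e) := by
  rw [contDiff_iff_contDiffAt]
  intro a
  obtain ⟨u, hu⟩ := hT a
  have h1 : ContDiffAt ℂ 1 Ring.inverse (1 - T a) := hu ▸ contDiffAt_ringInverse ℂ u
  have h2 : ContDiffAt ℂ 1 (fun a => 1 - T a) a := contDiffAt_const.sub T.contDiff.contDiffAt
  exact (h1.comp a h2).clm_apply contDiffAt_const

theorem fderiv_fixedPoint_apply {T : A →L[ℂ] E →L[ℂ] E} (hT : ∀ a, IsUnit (1 - T a))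
    (e : E) (a b : A) :
    fderiv ℂ (fixedPoint T e) a b =
      T b (fixedPoint T e a) + T a (fderiv ℂ (fixedPoint T e) a b) :=
  fderiv_apply_of_forall_eq_add ((contDiff_fixedPoint hT e).differentiable (by norm_num)) T e
    (fixedPoint_eq hT e) a b

end Resolvent

/-! ### Volterra operators and the propagator -/

section Volterra

variable {R : Type*} [NormedRing R] [NormedAlgebra ℂ R]

/-- The primitive `x ↦ ∫₀ˣ f` of a continuous function on `[-1, 1]`. -/
noncomputable def primitive : C(Icc (-1 : ℝ) 1, R) →L[ℂ] C(Icc (-1 : ℝ) 1, R) :=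
  LinearMap.mkContinuous
    { toFun := fun f =>
        { toFun := fun x => ∫ s in (0 : ℝ)..x, f (projIcc (-1) 1 (by norm_num) s)
          continuous_toFun := by
            have h : Continuous fun s : ℝ => f (projIcc (-1) 1 (by norm_num) s) :=
              f.continuous.comp continuous_projIcc
            exact (intervalIntegral.continuous_primitive
              (fun a b => h.intervalIntegrable a b) 0).comp continuous_subtype_val }
      map_add' := fun f g => by
        ext x
        have h : ∀ f : C(Icc (-1 : ℝ) 1, R),
            Continuous fun s : ℝ => f (projIcc (-1) 1 (by norm_num) s) :=
          fun f => f.continuous.comp continuous_projIcc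
        simpa using intervalIntegral.integral_add
          ((h f).intervalIntegrable 0 x) ((h g).intervalIntegrable 0 x)
      map_smul' := fun c f => by
        ext x
        simp }
    1 (fun f => by
      rw [one_mul, ContinuousMap.norm_le _ (norm_nonneg _)]
      intro x
      have h := intervalIntegral.norm_integral_le_of_norm_le_const (a := 0) (b := (x : ℝ))
        (f := fun s => f (projIcc (-1) 1 (by norm_num) s)) (C := ‖f‖)
        (fun s _ => f.norm_coe_le_norm _)
      have hx : |(x : ℝ) - 0| ≤ 1 := by
        rw [sub_zero, abs_le]; exact x.2
      calc _ ≤ ‖f‖ * |(x : ℝ) - 0| := h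
        _ ≤ ‖f‖ * 1 := by gcongr
        _ = ‖f‖ := mul_one _)

theorem primitive_apply (f : C(Icc (-1 : ℝ) 1, R)) (x : Icc (-1 : ℝ) 1) :
    primitive f x = ∫ s in (0 : ℝ)..x, f (projIcc (-1) 1 (by norm_num) s) := rfl

/-- The Volterra operator `f ↦ ∫₀ˣ a f`, linear in the coefficient `a`. -/
noncomputable def volterra :
    C(Icc (-1 : ℝ) 1, R) →L[ℂ] C(Icc (-1 : ℝ) 1, R) →L[ℂ] C(Icc (-1 : ℝ) 1, R) :=
  (ContinuousLinearMap.compL ℂ _ _ _ primitive).comp (ContinuousLinearMap.mul ℂ _)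

theorem volterra_apply (a f : C(Icc (-1 : ℝ) 1, R)) : volterra a f = primitive (a * f) := rfl

theorem norm_volterra_pow_apply_le (a f : C(Icc (-1 : ℝ) 1, R)) (n : ℕ) (x : Icc (-1 : ℝ) 1) :
    ‖(volterra a ^ n) f x‖ ≤ (‖a‖ * |(x : ℝ)|) ^ n / n.factorial * ‖f‖ := by
  induction n generalizing x with
  | zero => simpa using f.norm_coe_le_norm x
  | succ n ih =>
    rw [pow_succ', mul_apply_eq_comp, volterra_apply, primitive_apply]
    set g := (volterra a ^ n) f
    have hg : ∀ s ∈ uIoc (0 : ℝ) x, ‖(a * g) (projIcc (-1) 1 (by norm_num) s)‖ ≤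
        ‖a‖ * ((‖a‖ * |s - 0|) ^ n / n.factorial * ‖f‖) := by
      intro s hs
      have hs' : s ∈ Icc (-1 : ℝ) 1 := by
        have h0 : (0 : ℝ) ∈ Icc (-1 : ℝ) 1 := by norm_num
        exact uIcc_subset_Icc h0 x.2 (uIoc_subset_uIcc hs)
      rw [projIcc_of_mem _ hs', ContinuousMap.mul_apply, sub_zero]
      refine (norm_mul_le _ _).trans ?_
      gcongr
      · exact a.norm_coe_le_norm _
      · exact ih ⟨s, hs'⟩
    have hint : IntegrableOn (fun s : ℝ => ‖a‖ * ((‖a‖ * |s - 0|) ^ n / n.factorial * ‖f‖))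
        (uIoc (0 : ℝ) x) := by
      rw [← intervalIntegrable_iff]
      apply Continuous.intervalIntegrable
      fun_prop
    calc _ ≤ ∫ s in uIoc (0 : ℝ) x, ‖(a * g) (projIcc (-1) 1 (by norm_num) s)‖ :=
          intervalIntegral.norm_integral_le_integral_norm_uIoc
      _ ≤ ∫ s in uIoc (0 : ℝ) x, ‖a‖ * ((‖a‖ * |s - 0|) ^ n / n.factorial * ‖f‖) := by
          refine setIntegral_mono_on ?_ hint measurableSet_uIoc hg
          rw [← intervalIntegrable_iff]
          apply Continuous.intervalIntegrable
          exact ((a * g).continuous.comp continuous_projIcc).norm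
      _ = ∫ s in uIoc (0 : ℝ) x, (‖a‖ ^ (n + 1) / n.factorial * ‖f‖) * |s - 0| ^ n := by
          congr 1; ext s; ring
      _ = _ := by
          rw [integral_const_mul, integral_pow_abs_sub_uIoc, Nat.factorial_succ]
          push_cast
          have : (n.factorial : ℝ) ≠ 0 := by positivity
          rw [sub_zero, mul_pow]
          field_simp

variable [CompleteSpace R]

/-- The Volterra operator is quasinilpotent. -/
theorem isUnit_one_sub_volterra (a : C(Icc (-1 : ℝ) 1, R)) : IsUnit (1 - volterra a) := by
  obtain ⟨n, hn⟩ := ((FloorSemiring.tendsto_pow_div_factorial_atTop ‖a‖).eventually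
    (gt_mem_nhds (show (0 : ℝ) < 1 by norm_num))).exists
  have hnorm : ‖volterra a ^ n‖ < 1 := by
    refine lt_of_le_of_lt (ContinuousLinearMap.opNorm_le_bound _ (by positivity) fun f => ?_) hn
    rw [ContinuousMap.norm_le _ (by positivity)]
    intro x
    refine (norm_volterra_pow_apply_le a f n x).trans ?_
    have hx : |(x : ℝ)| ≤ 1 := abs_le.2 x.2
    gcongr
    exact mul_le_of_le_one_right (norm_nonneg _) hx
  exact isUnit_one_sub_of_norm_pow_lt_one hnorm

/-- The solution on `[-1, 1]` of `U' = a U`, `U(0) = 1`, as the fixed point of `U = 1 + ∫₀ˣ a U`.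
The interval contains `0` in its interior so that the equation holds in a neighborhood of `0`. -/
noncomputable def propagator (a : C(Icc (-1 : ℝ) 1, R)) : C(Icc (-1 : ℝ) 1, R) :=
  fixedPoint (A := C(Icc (-1 : ℝ) 1, R)) (E := C(Icc (-1 : ℝ) 1, R))
    volterra 1 a

theorem propagator_eq (a : C(Icc (-1 : ℝ) 1, R)) :
    propagator a = 1 + volterra a (propagator a) := by
  unfold propagator
  exact fixedPoint_eq (A := C(Icc (-1 : ℝ) 1, R)) (E := C(Icc (-1 : ℝ) 1, R))
    isUnit_one_sub_volterra 1 a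

theorem eq_propagator {a f : C(Icc (-1 : ℝ) 1, R)} (hf : f = 1 + volterra a f) :
    f = propagator a := by
  unfold propagator
  exact eq_fixedPoint (A := C(Icc (-1 : ℝ) 1, R)) (E := C(Icc (-1 : ℝ) 1, R))
    isUnit_one_sub_volterra hf

theorem contDiff_propagator : ContDiff ℂ 1 (propagator (R := R)) := by
  unfold propagator
  exact contDiff_fixedPoint (A := C(Icc (-1 : ℝ) 1, R)) (E := C(Icc (-1 : ℝ) 1, R))
    isUnit_one_sub_volterra 1

/-- The derivative `y` of the propagator in the direction `b` solves `y' = a y + b U`,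
`y(0) = 0`. -/
theorem fderiv_propagator_apply (a b : C(Icc (-1 : ℝ) 1, R)) :
    fderiv ℂ propagator a b =
      volterra b (propagator a) + volterra a (fderiv ℂ propagator a b) := by
  unfold propagator
  exact fderiv_fixedPoint_apply (A := C(Icc (-1 : ℝ) 1, R)) (E := C(Icc (-1 : ℝ) 1, R))
    isUnit_one_sub_volterra 1 a b

end Volterra

/-! ### Fundamental solutions of linear differential equations -/

section LinearODE

variable {R : Type*} [NormedRing R] [NormedAlgebra ℂ R]

theorem linear_ode_unique {A : ℝ → R} (hA : Continuous A) {L : ℝ} (hL : 0 < L) {y z : ℝ → R}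
    (hy : ∀ x ∈ Ioo (-L) L, HasDerivAt y (A x * y x) x)
    (hz : ∀ x ∈ Ioo (-L) L, HasDerivAt z (A x * z x) x) (h0 : y 0 = z 0) :
    EqOn y z (Ioo (-L) L) := by
  obtain ⟨C, hC⟩ := isCompact_Icc.exists_bound_of_continuousOn (s := Icc (-L) L) hA.continuousOn
  have hLip : ∀ t ∈ Ioo (-L) L,
      LipschitzOnWith C.toNNReal (fun w : R => A t * w) univ := by
    intro t ht
    refine LipschitzOnWith.of_dist_le_mul fun u _ v _ => ?_
    rw [dist_eq_norm, dist_eq_norm, ← mul_sub]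
    refine (norm_mul_le _ _).trans ?_
    gcongr
    exact (hC t (Ioo_subset_Icc_self ht)).trans (Real.le_coe_toNNReal C)
  exact ODE_solution_unique_of_mem_Ioo (v := fun t w => A t * w) (s := fun _ => univ)
    hLip (t₀ := 0) ⟨by linarith, hL⟩ (fun t ht => ⟨hy t ht, mem_univ _⟩)
    (fun t ht => ⟨hz t ht, mem_univ _⟩) h0

theorem linear_ode_unique_univ {A : ℝ → R} (hA : Continuous A) {y z : ℝ → R}
    (hy : ∀ x, HasDerivAt y (A x * y x) x) (hz : ∀ x, HasDerivAt z (A x * z x) x)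
    (h0 : y 0 = z 0) : y = z := by
  funext x
  have hL : 0 < |x| + 1 := by positivity
  refine linear_ode_unique hA hL (fun t _ => hy t) (fun t _ => hz t) h0 ?_
  exact ⟨by linarith [neg_abs_le x], by linarith [le_abs_self x]⟩

/-- `U` is the fundamental solution of `y' = A y` on the real line. -/
def IsFundamental (A U : ℝ → R) : Prop :=
  U 0 = 1 ∧ ∀ x, HasDerivAt U (A x * U x) x

/-- Floquet's relation `U(x + 1) = U(x) U(1)` for a `1`-periodic coefficient. -/
theorem IsFundamental.add_one {A U : ℝ → R} (hA : Continuous A) (hper : Function.Periodic A 1)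
    (hU : IsFundamental A U) (x : ℝ) : U (x + 1) = U x * U 1 := by
  have h := linear_ode_unique_univ hA (y := fun x => U (x + 1)) (z := fun x => U x * U 1)
    (fun x => by
      have := (hU.2 (x + 1)).comp_add_const x 1
      rwa [hper x] at this)
    (fun x => by
      have := (hU.2 x).mul_const (U 1)
      rwa [mul_assoc] at this)
    (by simp [hU.1])
  exact congrFun h x

/-- The coefficient `A` on `[-L, L]`, rescaled to `[-1, 1]`. -/
noncomputable def rescale (A : ℝ → R) (hA : Continuous A) (L : ℝ) : C(Icc (-1 : ℝ) 1, R) :=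
  ⟨fun t => L • A (L * t), by fun_prop⟩

variable [CompleteSpace R]

theorem hasDerivAt_propagator (a : C(Icc (-1 : ℝ) 1, R)) {t : ℝ} (ht : t ∈ Ioo (-1 : ℝ) 1) :
    HasDerivAt (fun s => propagator a (projIcc (-1) 1 (by norm_num) s))
      (a ⟨t, Ioo_subset_Icc_self ht⟩ * propagator a (projIcc (-1) 1 (by norm_num) t)) t := by
  have hc : Continuous fun s : ℝ => (a * propagator a) (projIcc (-1) 1 (by norm_num) s) :=
    (a * propagator a).continuous.comp continuous_projIcc
  have h := ((intervalIntegral.integral_hasDerivAt_right (hc.intervalIntegrable 0 t)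
    (hc.stronglyMeasurableAtFilter _ _) hc.continuousAt).const_add (1 : R))
  rw [ContinuousMap.mul_apply] at h
  nth_rewrite 1 [projIcc_of_mem _ (Ioo_subset_Icc_self ht)] at h
  refine h.congr_of_eventuallyEq ?_
  filter_upwards [Ioo_mem_nhds ht.1 ht.2] with s hs
  have hs' := congrArg (fun f => f ⟨s, Ioo_subset_Icc_self hs⟩) (propagator_eq a)
  rw [projIcc_of_mem _ (Ioo_subset_Icc_self hs)]
  simpa [volterra_apply, primitive_apply] using hs'

theorem propagator_zero (a : C(Icc (-1 : ℝ) 1, R)) :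
    propagator a (projIcc (-1) 1 (by norm_num) 0) = 1 := by
  have h0 : (0 : ℝ) ∈ Icc (-1 : ℝ) 1 := by norm_num
  have h := congrArg (fun f => f ⟨0, h0⟩) (propagator_eq a)
  rw [projIcc_of_mem _ h0]
  simpa [volterra_apply, primitive_apply] using h

theorem exists_local_solution {A : ℝ → R} (hA : Continuous A) {L : ℝ} (hL : 0 < L) :
    ∃ y : ℝ → R, y 0 = 1 ∧ ∀ x ∈ Ioo (-L) L, HasDerivAt y (A x * y x) x := by
  refine ⟨fun x => propagator (rescale A hA L) (projIcc (-1) 1 (by norm_num) (L⁻¹ * x)), ?_, ?_⟩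
  · simpa using propagator_zero (rescale A hA L)
  · intro x hx
    have hx' : L⁻¹ * x ∈ Ioo (-1 : ℝ) 1 := by
      rw [inv_mul_eq_div]
      exact ⟨by rw [lt_div_iff₀ hL]; linarith [hx.1], by rw [div_lt_one hL]; exact hx.2⟩
    have h1 : HasDerivAt (fun x : ℝ => L⁻¹ * x) L⁻¹ x := by
      simpa using (hasDerivAt_id x).const_mul L⁻¹
    have h := (hasDerivAt_propagator (rescale A hA L) hx').scomp x h1
    have ha : rescale A hA L ⟨L⁻¹ * x, Ioo_subset_Icc_self hx'⟩ = L • A x := by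
      change L • A (L * (L⁻¹ * x)) = L • A x
      rw [mul_inv_cancel_left₀ hL.ne']
    rw [ha, smul_mul_assoc, smul_smul, inv_mul_cancel₀ hL.ne', one_smul] at h
    exact h

/-- The local solutions agree where both are defined, so they glue. -/
theorem exists_isFundamental {A : ℝ → R} (hA : Continuous A) : ∃ U, IsFundamental A U := by
  choose y hy0 hy using fun n : ℕ =>
    exists_local_solution hA (L := (n : ℝ) + 1) (by positivity)
  have hmono : ∀ m n : ℕ, m ≤ n → EqOn (y m) (y n) (Ioo (-((m : ℝ) + 1)) (m + 1)) := by
    intro m n hmn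
    have hmn' : (m : ℝ) ≤ n := by exact_mod_cast hmn
    refine linear_ode_unique hA (by positivity) (hy m) (fun x hx => hy n x ?_)
      ((hy0 m).trans (hy0 n).symm)
    exact ⟨by linarith [hx.1], by linarith [hx.2]⟩
  have hceil : ∀ x : ℝ, x ∈ Ioo (-((⌈|x|⌉₊ : ℝ) + 1)) (⌈|x|⌉₊ + 1) := by
    intro x
    have := Nat.le_ceil |x|
    exact ⟨by linarith [neg_abs_le x], by linarith [le_abs_self x]⟩
  refine ⟨fun x => y ⌈|x|⌉₊ x, by simpa using hy0 0, fun x => ?_⟩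
  have hev : (fun x => y ⌈|x|⌉₊ x) =ᶠ[𝓝 x] y (⌈|x|⌉₊ + 1) := by
    have hopen : ∀ᶠ z in 𝓝 x, |z| < |x| + 1 :=
      continuous_abs.continuousAt.eventually (gt_mem_nhds (by linarith))
    filter_upwards [hopen] with z hz
    refine hmono _ _ ?_ (hceil z)
    rw [← Nat.ceil_add_one (abs_nonneg x)]
    exact Nat.ceil_mono hz.le
  have hx : x ∈ Ioo (-(((⌈|x|⌉₊ + 1 : ℕ) : ℝ) + 1)) ((⌈|x|⌉₊ + 1 : ℕ) + 1) := by
    have := hceil x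
    push_cast
    exact ⟨by linarith [this.1], by linarith [this.2]⟩
  have h := (hy (⌈|x|⌉₊ + 1) x hx).congr_of_eventuallyEq hev
  rwa [← hev.eq_of_nhds] at h

/-- A fundamental solution restricted to `[-1, 1]` is the propagator. -/
theorem IsFundamental.eq_propagator {A U : ℝ → R} (hA : Continuous A) (hU : IsFundamental A U)
    {a : C(Icc (-1 : ℝ) 1, R)} (ha : ∀ t, a t = A t) (t : Icc (-1 : ℝ) 1) :
    U t = propagator a t := by
  have hUc : Continuous U := continuous_iff_continuousAt.2 fun x => (hU.2 x).continuousAt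
  set f : C(Icc (-1 : ℝ) 1, R) := ⟨fun t => U t, by fun_prop⟩ with hf
  have key : f = 1 + volterra a f := by
    ext x
    have h := intervalIntegral.integral_eq_sub_of_hasDerivAt (a := 0) (b := (x : ℝ))
      (fun s _ => hU.2 s) ((hA.mul hUc).intervalIntegrable _ _)
    have h2 : ∫ s in (0 : ℝ)..x, (a * f) (projIcc (-1) 1 (by norm_num) s) =
        ∫ s in (0 : ℝ)..x, A s * U s := by
      refine intervalIntegral.integral_congr fun s hs => ?_
      have hs' : s ∈ Icc (-1 : ℝ) 1 := by
        have h0 : (0 : ℝ) ∈ Icc (-1 : ℝ) 1 := by norm_num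
        exact uIcc_subset_Icc h0 x.2 hs
      simp [projIcc_of_mem _ hs', ha, hf]
    simp only [ContinuousMap.add_apply, volterra_apply, primitive_apply, ContinuousMap.one_apply]
    rw [h2, h, hU.1]
    simp [hf]
  exact congrArg (fun g => g t) (SidebandNLS.eq_propagator key)

end LinearODE

/-! ### An inverse function theorem for blow-ups -/

section ScaledInverse

open Asymptotics Metric

variable {E F G : Type*} [NormedAddCommGroup E] [NormedSpace ℝ E] [NormedAddCommGroup F]
  [NormedSpace ℝ F] [NormedAddCommGroup G] [NormedSpace ℝ G]

theorem isLittleO_inv_smul_of_smul {ι : Type*} {l : Filter ι} {c : ι → ℝ} {f : ι → F} {h : ι → E}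
    (hc : ∀ᶠ i in l, c i ≠ 0) (hf : f =o[l] fun i => c i • h i) :
    (fun i => (c i)⁻¹ • f i) =o[l] h := by
  refine ((isBigO_refl (fun i => (c i)⁻¹) l).smul_isLittleO hf).congr' EventuallyEq.rfl ?_
  filter_upwards [hc] with i hi
  rw [smul_smul, inv_mul_cancel₀ hi, one_smul]

variable {X : E × ℝ → F} {X' : E × ℝ →L[ℝ] F} {p : E} {u₀ : E}

/-- The blow-up `X(p + ε u, ε) / ε` converges to the derivative, in the direction `(u, 1)`. -/
theorem tendsto_inv_smul_scaled (hX : HasStrictFDerivAt X X' (p, 0)) (hX0 : X (p, 0) = 0) :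
    Tendsto (fun q : ℝ × E => q.1⁻¹ • X (p + q.1 • q.2, q.1)) (𝓝[≠] 0 ×ˢ 𝓝 u₀)
      (𝓝 (X' (u₀, 1))) := by
  have hk : Tendsto (fun q : ℝ × E => (p + q.1 • q.2, q.1)) (𝓝[≠] 0 ×ˢ 𝓝 u₀) (𝓝 (p, 0)) := by
    have hc : Continuous fun q : ℝ × E => (p + q.1 • q.2, q.1) := by fun_prop
    have := hc.tendsto (0, u₀)
    simp only [zero_smul, add_zero] at this
    refine this.mono_left ?_
    rw [nhds_prod_eq]
    exact Filter.prod_mono nhdsWithin_le_nhds le_rfl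
  have h1 := hX.hasFDerivAt.isLittleO.comp_tendsto hk
  have h2 := isLittleO_inv_smul_of_smul (c := fun q : ℝ × E => q.1)
    (h := fun q : ℝ × E => (q.2, (1 : ℝ))) (l := 𝓝[≠] 0 ×ˢ 𝓝 u₀)
    (tendsto_fst.eventually eventually_mem_nhdsWithin)
    (h1.congr_right fun q => by simp)
  have hb : (fun q : ℝ × E => (q.2, (1 : ℝ))) =O[𝓝[≠] (0 : ℝ) ×ˢ 𝓝 u₀] fun _ => (1 : ℝ) := by
    have h : Tendsto (fun q : ℝ × E => (q.2, (1 : ℝ))) (𝓝[≠] (0 : ℝ) ×ˢ 𝓝 u₀) (𝓝 (u₀, 1)) :=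
      tendsto_snd.prodMk_nhds tendsto_const_nhds
    exact h.isBigO_one ℝ
  have h3 := (h2.trans_isBigO hb).tendsto_zero_of_tendsto tendsto_const_nhds
  have h4 : Tendsto (fun q : ℝ × E => X' (q.2, 1)) (𝓝[≠] 0 ×ˢ 𝓝 u₀) (𝓝 (X' (u₀, 1))) :=
    (X'.continuous.tendsto _).comp (tendsto_snd.prodMk_nhds tendsto_const_nhds)
  have h5 := h3.add h4
  rw [zero_add] at h5
  refine h5.congr' ?_
  filter_upwards [tendsto_fst.eventually eventually_mem_nhdsWithin] with q hq
  have hq' : q.1 ≠ 0 := hq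
  have : ((q.2, 1) : E × ℝ) = q.1⁻¹ • (q.1 • q.2, q.1) := by
    simp [smul_smul, hq']
  have e : ((p + q.1 • q.2, q.1) : E × ℝ) - (p, 0) = (q.1 • q.2, q.1) := by simp
  rw [this, map_smul, ← smul_add]
  simp only [Function.comp_apply]
  rw [e, hX0, sub_zero, sub_add_cancel]

/-- The differences of the blow-up are close to those of its limit, with a Lipschitz constant that
tends to zero. This is where strict differentiability is needed. -/
theorem isLittleO_inv_smul_scaled_sub (hX : HasStrictFDerivAt X X' (p, 0)) :
    (fun q : ℝ × E × E => q.1⁻¹ • X (p + q.1 • q.2.1, q.1) - q.1⁻¹ • X (p + q.1 • q.2.2, q.1) -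
      X' (q.2.1 - q.2.2, 0)) =o[𝓝[≠] 0 ×ˢ 𝓝 (u₀, u₀)] fun q => q.2.1 - q.2.2 := by
  have hk : Tendsto (fun q : ℝ × E × E => ((p + q.1 • q.2.1, q.1), (p + q.1 • q.2.2, q.1)))
      (𝓝[≠] 0 ×ˢ 𝓝 (u₀, u₀)) (𝓝 ((p, 0), (p, 0))) := by
    have hc : Continuous fun q : ℝ × E × E =>
      (((p + q.1 • q.2.1, q.1), (p + q.1 • q.2.2, q.1)) : (E × ℝ) × (E × ℝ)) := by fun_prop
    have := hc.tendsto (0, u₀, u₀)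
    simp only [zero_smul, add_zero] at this
    refine this.mono_left ?_
    rw [show 𝓝 ((0 : ℝ), u₀, u₀) = 𝓝 0 ×ˢ 𝓝 (u₀, u₀) from nhds_prod_eq]
    exact Filter.prod_mono nhdsWithin_le_nhds le_rfl
  have h1 := hX.isLittleO.comp_tendsto hk
  have h2 := isLittleO_inv_smul_of_smul (c := fun q : ℝ × E × E => q.1)
    (h := fun q : ℝ × E × E => (q.2.1 - q.2.2, (0 : ℝ))) (l := 𝓝[≠] 0 ×ˢ 𝓝 (u₀, u₀))
    (tendsto_fst.eventually eventually_mem_nhdsWithin)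
    (h1.congr_right fun q => by simp [smul_sub])
  have hb : (fun q : ℝ × E × E => (q.2.1 - q.2.2, (0 : ℝ))) =O[𝓝[≠] (0 : ℝ) ×ˢ 𝓝 (u₀, u₀)]
      fun q => q.2.1 - q.2.2 := isBigO_of_le _ fun q => by simp
  refine (h2.trans_isBigO hb).congr' ?_ EventuallyEq.rfl
  filter_upwards [tendsto_fst.eventually eventually_mem_nhdsWithin] with q hq
  have hq' : q.1 ≠ 0 := hq
  have : ((q.2.1 - q.2.2, 0) : E × ℝ) =
      q.1⁻¹ • ((p + q.1 • q.2.1, q.1) - (p + q.1 • q.2.2, q.1)) := by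
    simp [← smul_sub, smul_smul, hq']
  rw [this, map_smul, ← smul_sub, ← smul_sub]
  rfl

/-- An inverse function theorem for the blow-up `u ↦ X(p + ε u, ε) / ε` of a map vanishing at
`(p, 0)`, followed by a map `Q`. As `ε → 0` the composition is close in `C¹` to
`u ↦ Q(X'(u, 1))`, so it is invertible near `u₀`, with a range of values that does not shrink. -/
theorem exists_scaled_inverse [CompleteSpace E] [Nontrivial E]
    (hX : HasStrictFDerivAt X X' (p, 0)) (hX0 : X (p, 0) = 0)
    {Q : F → G} {Q' : F →L[ℝ] G} (hQ : HasStrictFDerivAt Q Q' (X' (u₀, 1)))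
    (L : E ≃L[ℝ] G) (hL : ∀ u, L u = Q' (X' (u, 0))) {ρ : ℝ} (hρ : 0 < ρ) :
    ∃ η > 0, ∃ ε₀ > 0, ∀ ε : ℝ, 0 < |ε| → |ε| < ε₀ → ∃ g : G → E,
      ContinuousOn g (closedBall (Q (X' (u₀, 1))) η) ∧
      ∀ v ∈ closedBall (Q (X' (u₀, 1))) η, g v ∈ ball u₀ ρ ∧
        Q (ε⁻¹ • X (p + ε • g v, ε)) = v := by
  set l : Filter (ℝ × E × E) := 𝓝[≠] 0 ×ˢ 𝓝 (u₀, u₀)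
  set x : ℝ → E → F := fun ε u => ε⁻¹ • X (p + ε • u, ε)
  have hlin : (fun q : ℝ × E × E => x q.1 q.2.1 - x q.1 q.2.2 - X' (q.2.1 - q.2.2, 0)) =o[l]
      fun q => q.2.1 - q.2.2 := isLittleO_inv_smul_scaled_sub hX
  have hbig : (fun q : ℝ × E × E => x q.1 q.2.1 - x q.1 q.2.2) =O[l] fun q => q.2.1 - q.2.2 := by
    have h : (fun q : ℝ × E × E => X' (q.2.1 - q.2.2, 0)) =O[l] fun q => q.2.1 - q.2.2 := by
      refine IsBigO.of_bound ‖X'‖ (Eventually.of_forall fun q => ?_)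
      simpa using X'.le_opNorm (q.2.1 - q.2.2, 0)
    simpa using hlin.isBigO.add h
  have ht : Tendsto (fun q : ℝ × E × E => (x q.1 q.2.1, x q.1 q.2.2)) l
      (𝓝 (X' (u₀, 1), X' (u₀, 1))) := by
    have h := tendsto_inv_smul_scaled (u₀ := u₀) hX hX0
    have e1 : Tendsto (fun q : ℝ × E × E => (q.1, q.2.1)) l (𝓝[≠] 0 ×ˢ 𝓝 u₀) :=
      tendsto_fst.prodMk ((continuous_fst.tendsto (u₀, u₀)).comp tendsto_snd)
    have e2 : Tendsto (fun q : ℝ × E × E => (q.1, q.2.2)) l (𝓝[≠] 0 ×ˢ 𝓝 u₀) :=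
      tendsto_fst.prodMk ((continuous_snd.tendsto (u₀, u₀)).comp tendsto_snd)
    exact (h.comp e1).prodMk_nhds (h.comp e2)
  have hΦ : (fun q : ℝ × E × E => Q (x q.1 q.2.1) - Q (x q.1 q.2.2) - L (q.2.1 - q.2.2)) =o[l]
      fun q => q.2.1 - q.2.2 := by
    have h1 := (hQ.isLittleO.comp_tendsto ht).trans_isBigO hbig
    have h2 := (Q'.isBigO_comp (fun q : ℝ × E × E =>
      x q.1 q.2.1 - x q.1 q.2.2 - X' (q.2.1 - q.2.2, 0)) l).trans_isLittleO hlin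
    refine (h1.add h2).congr_left fun q => ?_
    rw [hL, map_sub Q']
    simp
  set N := ‖(L.symm : G →L[ℝ] E)‖₊
  have hNpos : 0 < N := L.nnnorm_symm_pos
  obtain ⟨pa, ha, pb, hb, hab⟩ := eventually_prod_iff.1
    (hΦ.def (c := ((N⁻¹ / 2 : NNReal) : ℝ)) (by positivity))
  rw [nhds_prod_eq] at hb
  obtain ⟨ρ₁, hρ₁, hball⟩ : ∃ ρ₁ > 0, ∀ u ∈ ball u₀ ρ₁, ∀ v ∈ ball u₀ ρ₁, pb (u, v) := by
    rw [← nhds_prod_eq, Metric.eventually_nhds_iff] at hb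
    obtain ⟨ρ₁, hρ₁, h⟩ := hb
    exact ⟨ρ₁, hρ₁, fun u hu v hv => h (by simpa [Prod.dist_eq] using And.intro hu hv)⟩
  set ρ₂ := min ρ ρ₁
  have hρ₂ : 0 < ρ₂ := lt_min hρ hρ₁
  set η : ℝ := ((N⁻¹ - N⁻¹ / 2 : NNReal) : ℝ) * (ρ₂ / 2) / 2 with hη
  have hNhalf : N⁻¹ / 2 < N⁻¹ := NNReal.half_lt_self (by positivity)
  have hηpos : 0 < η := by
    have : 0 < N⁻¹ - N⁻¹ / 2 := tsub_pos_of_lt hNhalf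
    positivity
  have hc : ∀ᶠ ε in 𝓝[≠] (0 : ℝ), dist (Q (x ε u₀)) (Q (X' (u₀, 1))) < η := by
    have h := tendsto_inv_smul_scaled (u₀ := u₀) hX hX0
    have e1 : Tendsto (fun ε : ℝ => (ε, u₀)) (𝓝[≠] 0) (𝓝[≠] 0 ×ˢ 𝓝 u₀) :=
      tendsto_id.prodMk tendsto_const_nhds
    exact (hQ.continuousAt.tendsto.comp (h.comp e1)).eventually (ball_mem_nhds _ hηpos)
  obtain ⟨ε₀, hε₀, hsmall⟩ := Metric.eventually_nhds_iff.1 (eventually_nhdsWithin_iff.1 (ha.and hc))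
  refine ⟨η, hηpos, ε₀, hε₀, fun ε hε0 hε => ?_⟩
  obtain ⟨hpa, hdist⟩ := hsmall (y := ε) (by simpa using hε) (abs_pos.1 hε0)
  -- at fixed `ε` the composition approximates `L`, with a constant that does not depend on `ε`
  have happ : ApproximatesLinearOn (fun u => Q (x ε u)) (L : E →L[ℝ] G) (ball u₀ ρ₂)
      (N⁻¹ / 2) := by
    rw [ApproximatesLinearOn]
    intro u hu v hv
    exact hab hpa (hball u (ball_subset_ball (min_le_right _ _) hu) v
      (ball_subset_ball (min_le_right _ _) hv))
  set e := happ.toOpenPartialHomeomorph (fun u => Q (x ε u)) (ball u₀ ρ₂) (Or.inr hNhalf)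
    isOpen_ball
  -- the image contains a ball of radius `2 η` about the value at `u₀`, which is `η`-close to
  -- the limit
  have htarget : closedBall (Q (X' (u₀, 1))) η ⊆ e.target := by
    have h := happ.closedBall_subset_target (Or.inr hNhalf) isOpen_ball (b := u₀) (ε := ρ₂ / 2)
      (by positivity) (closedBall_subset_ball (by linarith))
    refine subset_trans ?_ h
    refine closedBall_subset_closedBall' ?_
    rw [dist_comm]
    have : ((N : ℝ)⁻¹ - ((N⁻¹ / 2 : NNReal) : ℝ)) * (ρ₂ / 2) = η + η := by
      rw [hη, NNReal.coe_sub hNhalf.le, NNReal.coe_inv]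
      ring
    refine le_of_le_of_eq ?_ this.symm
    gcongr
  refine ⟨e.symm, e.continuousOn_symm.mono htarget, fun v hv => ⟨?_, ?_⟩⟩
  · have : e.symm v ∈ ball u₀ ρ₂ := e.map_target (htarget hv)
    exact ball_subset_ball (min_le_left _ _) this
  · exact e.right_inv (htarget hv)

end ScaledInverse

/-! ### Arcs parametrized by the discriminant -/

section Arc

/-- A curve `c` solving `(2 K - S)² = D` for real `K` is injective on a subinterval: two values of
`K` with the same image have the sum `S`, which is impossible near a `K` with `2 K ≠ S`. -/
theorem exists_injOn_subarc {a b : ℝ} (hab : a < b) {c : ℝ → ℂ} {S D : ℂ → ℂ}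
    (hS : ContinuousOn (fun K => S (c K)) (Icc a b))
    (h : ∀ K ∈ Icc a b, (2 * (K : ℂ) - S (c K)) ^ 2 = D (c K)) :
    ∃ a' b' : ℝ, a ≤ a' ∧ a' < b' ∧ b' ≤ b ∧ InjOn c (Icc a' b') := by
  -- if `S = 2 K` throughout, then `c K` determines `K`
  by_cases h0 : ∀ K ∈ Icc a b, S (c K) = 2 * (K : ℂ)
  · refine ⟨a, b, le_rfl, hab, le_rfl, fun K hK K' hK' hc => ?_⟩
    have h1 := (h0 K hK).symm.trans ((congrArg S hc).trans (h0 K' hK'))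
    exact_mod_cast mul_left_cancel₀ two_ne_zero h1
  push Not at h0
  obtain ⟨K₀, hK₀, hne⟩ := h0
  set f : ℝ → ℂ := fun K => S (c K) - 2 * (K : ℂ) with hf
  have hfc : ContinuousOn f (Icc a b) := hS.sub (by fun_prop)
  have hf0 : f K₀ ≠ 0 := sub_ne_zero.2 hne
  obtain ⟨η, hη, hclose⟩ := Metric.continuousWithinAt_iff.1 (hfc K₀ hK₀) ‖f K₀‖ (norm_pos_iff.2 hf0)
  refine ⟨max a (K₀ - η / 2), min b (K₀ + η / 2), le_max_left _ _, ?_, min_le_left _ _, ?_⟩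
  · have := hK₀.1
    have := hK₀.2
    rw [max_lt_iff, lt_min_iff, lt_min_iff]
    refine ⟨⟨hab, by linarith⟩, by linarith, by linarith⟩
  · intro K hK K' hK' hc
    by_contra hKK
    have hm : ∀ x ∈ Icc (max a (K₀ - η / 2)) (min b (K₀ + η / 2)),
        x ∈ Icc a b ∧ dist x K₀ < η := by
      intro x hx
      have h1 := max_le_iff.1 hx.1
      have h2 := le_min_iff.1 hx.2
      refine ⟨⟨h1.1, h2.1⟩, ?_⟩
      rw [Real.dist_eq, abs_lt]
      constructor <;> linarith
    obtain ⟨hKm, hKd⟩ := hm K hK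
    obtain ⟨hKm', hKd'⟩ := hm K' hK'
    -- two parameters with the same image are the two roots of one quadratic, with sum `S (c K)`
    have hsum : f K + f K' = 0 := by
      have h1 := h K hKm
      have h2 := h K' hKm'
      rw [← hc] at h2
      have h3 : ((K : ℂ) - K') * (f K + f K') = 0 := by
        simp only [hf, ← hc]
        linear_combination (-1 / 2 : ℂ) * (h1 - h2)
      refine (mul_eq_zero.1 h3).resolve_left (sub_ne_zero.2 ?_)
      exact_mod_cast hKK
    have h1 := hclose hKm hKd
    have h2 := hclose hKm' hKd'
    rw [dist_eq_norm] at h1 h2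
    have h3 : (2 : ℂ) * f K₀ = -((f K - f K₀) + (f K' - f K₀)) := by linear_combination hsum
    have h4 : ‖(2 : ℂ) * f K₀‖ < 2 * ‖f K₀‖ := by
      rw [h3, norm_neg]
      exact (norm_add_le _ _).trans_lt (by linarith)
    simp at h4

theorem hasBandOffRealAxis_of_subarc {T : Set ℂ} {z₀ : ℂ} {r a b : ℝ} (hab : a < b) {c : ℝ → ℂ}
    (hc : ContinuousOn c (Icc a b)) (hinj : InjOn c (Icc a b))
    (hT : ∀ K ∈ Icc a b, c K ∈ T ∧ (c K).im ≠ 0 ∧ ‖c K - z₀‖ < r) :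
    HasBandOffRealAxis T z₀ r := by
  have hmaps : MapsTo (fun t : ℝ => a + t * (b - a)) (Icc 0 1) (Icc a b) := by
    intro t ht
    have := mul_nonneg ht.1 (sub_pos.2 hab).le
    have := mul_nonneg (sub_nonneg.2 ht.2) (sub_pos.2 hab).le
    constructor <;> simp only <;> linarith
  refine ⟨fun t => c (a + t * (b - a)), hc.comp (by fun_prop) hmaps, ?_,
    fun t ht => hT _ (hmaps ht)⟩
  refine hinj.comp (fun s _ t _ hst => ?_) hmaps
  exact mul_right_cancel₀ (sub_pos.2 hab).ne' (add_left_cancel hst)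

end Arc

/-! ### Symplectic matrices and Floquet multipliers -/

section Symplectic

open Matrix

/-- The symplectic form on the phase space of `(p, p', q, q')`. -/
def symplecticForm : Matrix (Fin 4) (Fin 4) ℂ :=
  !![0, 1, 0, 0;
     -1, 0, 0, 0;
     0, 0, 0, 1;
     0, 0, -1, 0]

theorem symplecticForm_mul_self : symplecticForm * symplecticForm = -1 := by
  ext i j
  fin_cases i <;> fin_cases j <;> simp [symplecticForm, Matrix.mul_apply, Fin.sum_univ_four]

/-- The symplectic adjoint `-J Mᵀ J`, which is the inverse of `M` when `M` is symplectic. -/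
def sympAdjoint (M : Matrix (Fin 4) (Fin 4) ℂ) : Matrix (Fin 4) (Fin 4) ℂ :=
  -(symplecticForm * Mᵀ * symplecticForm)

theorem sympAdjoint_eq (M : Matrix (Fin 4) (Fin 4) ℂ) : sympAdjoint M =
    !![M 1 1, -M 0 1, M 3 1, -M 2 1;
       -M 1 0, M 0 0, -M 3 0, M 2 0;
       M 1 3, -M 0 3, M 3 3, -M 2 3;
       -M 1 2, M 0 2, -M 3 2, M 2 2] := by
  ext i j
  simp only [sympAdjoint, Matrix.neg_apply, Matrix.mul_apply, Fin.sum_univ_four, transpose_apply]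
  fin_cases i <;> fin_cases j <;> simp [symplecticForm]

theorem sympAdjoint_mul {M : Matrix (Fin 4) (Fin 4) ℂ}
    (hM : Mᵀ * symplecticForm * M = symplecticForm) : sympAdjoint M * M = 1 := by
  rw [sympAdjoint, neg_mul, mul_assoc, mul_assoc, ← mul_assoc Mᵀ, hM, symplecticForm_mul_self,
    neg_neg]

theorem trace_sympAdjoint (M : Matrix (Fin 4) (Fin 4) ℂ) : (sympAdjoint M).trace = M.trace := by
  rw [sympAdjoint_eq]
  simp [Matrix.trace, Fin.sum_univ_four]
  ring

/-- The trace-free part `M + M⁻¹ - (Tr M / 2)` of `M + M⁻¹`, for symplectic `M`. Its eigenvalues are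
`±(K₊ - K₋) / 2`, each of them double. -/
noncomputable def splitting : Matrix (Fin 4) (Fin 4) ℂ →ₗ[ℂ] Matrix (Fin 4) (Fin 4) ℂ where
  toFun M := M + sympAdjoint M - (M.trace / 2) • 1
  map_add' M N := by
    simp only [sympAdjoint, transpose_add, mul_add, add_mul, trace_add, add_div, add_smul]
    abel
  map_smul' c M := by
    simp only [sympAdjoint, transpose_smul, mul_smul_comm, smul_mul_assoc, trace_smul, smul_sub,
      smul_add, smul_neg, RingHom.id_apply, smul_eq_mul, mul_div_assoc, mul_smul]

theorem splitting_apply (M : Matrix (Fin 4) (Fin 4) ℂ) :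
    splitting M = M + sympAdjoint M - (M.trace / 2) • 1 := rfl

/-- `M + sympAdjoint M` is self-adjoint for the symplectic form, so its eigenvalues are double and
the square of its trace-free part is a scalar matrix. -/
theorem splitting_mul_self (M : Matrix (Fin 4) (Fin 4) ℂ) :
    splitting M * splitting M = ((splitting M * splitting M).trace / 4) • 1 := by
  have h : splitting M = !![(M 0 0 + M 1 1 - M 2 2 - M 3 3) / 2, 0, M 0 2 + M 3 1, M 0 3 - M 2 1;
       0, (M 0 0 + M 1 1 - M 2 2 - M 3 3) / 2, M 1 2 - M 3 0, M 1 3 + M 2 0;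
       M 2 0 + M 1 3, M 2 1 - M 0 3, -(M 0 0 + M 1 1 - M 2 2 - M 3 3) / 2, 0;
       M 3 0 - M 1 2, M 3 1 + M 0 2, 0, -(M 0 0 + M 1 1 - M 2 2 - M 3 3) / 2] := by
    rw [splitting_apply, sympAdjoint_eq]
    ext i j
    fin_cases i <;> fin_cases j <;>
      simp [Matrix.trace, Fin.sum_univ_four] <;> ring
  rw [h]
  ext i j
  fin_cases i <;> fin_cases j <;>
    simp [Matrix.trace, Matrix.mul_apply, Fin.sum_univ_four] <;> ring

/-- For a symplectic matrix the trace of the square of its splitting is the radicand. -/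
theorem trace_splitting_sq {M : Matrix (Fin 4) (Fin 4) ℂ}
    (hM : Mᵀ * symplecticForm * M = symplecticForm) :
    (splitting M * splitting M).trace = 2 * (M ^ 2).trace - M.trace ^ 2 + 8 := by
  have h1 := sympAdjoint_mul hM
  have h2 : M * sympAdjoint M = 1 := mul_eq_one_comm.1 h1
  have h3 : (sympAdjoint M * sympAdjoint M).trace = (M ^ 2).trace := by
    have : sympAdjoint M * sympAdjoint M = sympAdjoint (M ^ 2) := by
      simp only [sympAdjoint, sq, transpose_mul, neg_mul_neg]
      rw [← mul_assoc, ← mul_assoc, mul_assoc (symplecticForm * Mᵀ), symplecticForm_mul_self]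
      simp [mul_assoc]
    rw [this, trace_sympAdjoint]
  have h4 : splitting M * splitting M = M ^ 2 + sympAdjoint M * sympAdjoint M + (1 + 1) -
      M.trace • (M + sympAdjoint M) + (M.trace / 2) ^ 2 • 1 := by
    rw [splitting_apply]
    simp only [mul_sub, sub_mul, add_mul, mul_add, h1, h2, smul_mul_assoc, mul_smul_comm, one_mul,
      mul_one, sq]
    module
  rw [h4]
  simp only [trace_add, trace_sub, trace_smul, trace_one, h3, trace_sympAdjoint]
  simp
  ring

/-- A root `K` of `(2 K - Tr M)² = D` is of the form `λ + λ⁻¹` for a Floquet multiplier `λ`; if `K`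
is in `(-2, 2)`, this `λ` is on the unit circle. -/
theorem exists_multiplier {M : Matrix (Fin 4) (Fin 4) ℂ}
    (hM : Mᵀ * symplecticForm * M = symplecticForm) {K : ℝ} (hK : K ∈ Ioo (-2 : ℝ) 2)
    (h : (2 * (K : ℂ) - M.trace) ^ 2 = (splitting M * splitting M).trace) :
    ∃ (z : ℂ) (v : Fin 4 → ℂ), ‖z‖ = 1 ∧ v ≠ 0 ∧ M *ᵥ v = z • v := by
  have h1 : M * sympAdjoint M = 1 := mul_eq_one_comm.1 (sympAdjoint_mul hM)
  set N := M + sympAdjoint M with hN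
  have hprod : (N - (K : ℂ) • 1) * (N - (M.trace - K) • 1) = 0 := by
    have e1 : N - (K : ℂ) • 1 = splitting M + (M.trace / 2 - K) • 1 := by
      rw [splitting_apply, hN]; module
    have e2 : N - (M.trace - K) • 1 = splitting M - (M.trace / 2 - K) • 1 := by
      rw [splitting_apply, hN]; module
    rw [e1, e2, add_mul, mul_sub, mul_sub, splitting_mul_self, ← h]
    simp only [smul_mul_assoc, mul_smul_comm, one_mul, mul_one, smul_smul]
    module
  have hdet : (N - (K : ℂ) • 1).det = 0 := by
    by_contra hdet
    -- otherwise the other factor vanishes, and its trace shows that the two factors coincide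
    have hu : IsUnit (N - (K : ℂ) • 1) :=
      (Matrix.isUnit_iff_isUnit_det _).2 (isUnit_iff_ne_zero.2 hdet)
    have h2 : N - (M.trace - K) • 1 = 0 := hu.mul_right_eq_zero.1 hprod
    have h3 := congrArg Matrix.trace h2
    simp only [hN, trace_sub, trace_add, trace_smul, trace_one, trace_sympAdjoint, trace_zero] at h3
    simp only [Fintype.card_fin, Nat.cast_ofNat, smul_eq_mul] at h3
    have h4 : M.trace - K = K := by linear_combination (-1 / 2 : ℂ) * h3
    rw [h4] at h2
    rw [h2] at hdet
    exact hdet Matrix.det_zero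
  obtain ⟨v, hv, hNv⟩ := Matrix.exists_mulVec_eq_zero_iff.2 hdet
  have hroot : (0 : ℝ) ≤ 4 - K ^ 2 := by nlinarith [hK.1, hK.2]
  set z : ℂ := ⟨K / 2, Real.sqrt (4 - K ^ 2) / 2⟩ with hz
  have hznorm : ∀ w : ℂ, w.re = K / 2 → w.im ^ 2 = (4 - K ^ 2) / 4 → ‖w‖ = 1 := by
    intro w h1 h2
    rw [← sq_eq_sq₀ (norm_nonneg _) zero_le_one, Complex.sq_norm, Complex.normSq_apply, h1]
    linear_combination h2
  have hzim : z.im ^ 2 = (4 - K ^ 2) / 4 := by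
    simp only [hz]
    rw [div_pow, Real.sq_sqrt hroot]
    norm_num
  have hzz : z * (K - z) = 1 := by
    apply Complex.ext
    · simp only [Complex.mul_re, Complex.sub_re, Complex.sub_im, Complex.ofReal_re,
        Complex.ofReal_im, Complex.one_re]
      have : z.re = K / 2 := rfl
      rw [this]
      linear_combination hzim
    · simp only [Complex.mul_im, Complex.sub_re, Complex.sub_im, Complex.ofReal_re,
        Complex.ofReal_im, Complex.one_im]
      have : z.re = K / 2 := rfl
      rw [this]
      ring
  -- an eigenvector of `M + M⁻¹` for `K` yields an eigenvector of `M` for `z` or for `K - z = z⁻¹`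
  have hfac : (M - z • 1) * (M - ((K : ℂ) - z) • 1) = M * (N - (K : ℂ) • 1) := by
    have e : M * (N - (K : ℂ) • 1) = M * M + 1 - (K : ℂ) • M := by
      rw [hN, mul_sub, mul_add, h1, mul_smul_comm, mul_one]
    rw [e]
    simp only [sub_mul M, mul_sub _ M, smul_mul_assoc, mul_smul_comm, one_mul, mul_one, smul_smul]
    rw [show ((K : ℂ) - z) * z = 1 by rw [mul_comm, hzz]]
    module
  have hzero : (M - z • 1) *ᵥ ((M - ((K : ℂ) - z) • 1) *ᵥ v) = 0 := by
    rw [Matrix.mulVec_mulVec, hfac, ← Matrix.mulVec_mulVec, hNv, Matrix.mulVec_zero]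
  by_cases hw : (M - ((K : ℂ) - z) • 1) *ᵥ v = 0
  · refine ⟨K - z, v, hznorm _ ?_ ?_, hv, ?_⟩
    · simp [hz]; ring
    · simpa using hzim
    · rw [Matrix.sub_mulVec, sub_eq_zero, Matrix.smul_mulVec, Matrix.one_mulVec] at hw
      exact hw
  · refine ⟨z, _, hznorm z rfl hzim, hw, ?_⟩
    rw [Matrix.sub_mulVec, sub_eq_zero, Matrix.smul_mulVec, Matrix.one_mulVec] at hzero
    exact hzero

end Symplectic

/-! ### Matrix differential equations -/

section MatrixODE

open Matrix

variable {n : ℕ}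

-- The choice of norm is immaterial; this one makes matrices a normed algebra.
noncomputable scoped instance : NormedRing (Matrix (Fin n) (Fin n) ℂ) := Matrix.linftyOpNormedRing
noncomputable scoped instance : NormedAlgebra ℂ (Matrix (Fin n) (Fin n) ℂ) :=
  Matrix.linftyOpNormedAlgebra

scoped instance : CompleteSpace (Matrix (Fin n) (Fin n) ℂ) :=
  inferInstanceAs (CompleteSpace (Fin n → Fin n → ℂ))

/-- The `(i, j)` entry of a matrix, as a continuous linear map. -/
noncomputable def entryCLM (i j : Fin n) : Matrix (Fin n) (Fin n) ℂ →L[ℂ] ℂ :=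
  LinearMap.toContinuousLinearMap (Matrix.entryLinearMap ℂ ℂ i j)

/-- The trace, as a continuous linear map. -/
noncomputable def traceCLM : Matrix (Fin n) (Fin n) ℂ →L[ℂ] ℂ :=
  LinearMap.toContinuousLinearMap (Matrix.traceLinearMap (Fin n) ℂ ℂ)

theorem hasDerivAt_matrix_iff {U : ℝ → Matrix (Fin n) (Fin n) ℂ} {U' : Matrix (Fin n) (Fin n) ℂ}
    {x : ℝ} : HasDerivAt U U' x ↔ ∀ i j, HasDerivAt (fun s => U s i j) (U' i j) x := by
  constructor
  · intro h i j
    exact ((entryCLM i j).restrictScalars ℝ).hasFDerivAt.comp_hasDerivAt x h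
  · intro h
    have h1 := HasDerivAt.fun_sum (u := Finset.univ) fun (p : Fin n × Fin n) _ =>
      (h p.1 p.2).smul_const (Matrix.single p.1 p.2 (1 : ℂ))
    have e : ∀ M : Matrix (Fin n) (Fin n) ℂ,
        ∑ p : Fin n × Fin n, M p.1 p.2 • Matrix.single p.1 p.2 (1 : ℂ) = M := by
      intro M
      rw [Fintype.sum_prod_type]
      conv_rhs => rw [Matrix.matrix_eq_sum_single M]
      simp
    simp only [e] at h1
    exact h1

theorem continuous_matrix_of_entries {X : Type*} [TopologicalSpace X]
    {A : X → Matrix (Fin n) (Fin n) ℂ} (h : ∀ i j, Continuous fun x => A x i j) : Continuous A :=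
  continuous_pi fun i => continuous_pi fun j => h i j

theorem IsFundamental.hasDerivAt_entry {A U : ℝ → Matrix (Fin n) (Fin n) ℂ}
    (hU : IsFundamental A U) (x : ℝ) (i j : Fin n) :
    HasDerivAt (fun s => U s i j) (∑ k, A x i k * U x k j) x :=
  hasDerivAt_matrix_iff.1 (hU.2 x) i j

theorem IsSolutionOperator.isFundamental {A U : ℝ → Matrix (Fin n) (Fin n) ℝ}
    (h : IsSolutionOperator A U) :
    IsFundamental (fun x => (A x).map Complex.ofReal) (fun x => (U x).map Complex.ofReal) := by
  refine ⟨by simp [h.1], fun x => hasDerivAt_matrix_iff.2 fun i j => ?_⟩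
  change HasDerivAt _ (∑ k, (A x i k : ℂ) * (U x k j : ℂ)) x
  refine (h.2 x i j).ofReal_comp.congr_deriv ?_
  simp [Matrix.mul_apply]

/-- The real part of the complex fundamental solution solves the real system. -/
theorem exists_isSolutionOperator {A : ℝ → Matrix (Fin n) (Fin n) ℝ}
    (hA : ∀ i j, Continuous fun x => A x i j) : ∃ U, IsSolutionOperator A U := by
  have hAc : Continuous fun x => (A x).map Complex.ofReal :=
    continuous_matrix_of_entries fun i j => Complex.continuous_ofReal.comp (hA i j)
  obtain ⟨U, hU⟩ := exists_isFundamental hAc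
  refine ⟨fun x => (U x).map Complex.re, ?_, fun x i j => ?_⟩
  · ext i j
    simp [hU.1, Matrix.one_apply, apply_ite]
  · refine (Complex.reCLM.hasFDerivAt.comp_hasDerivAt x (hU.hasDerivAt_entry x i j)).congr_deriv ?_
    simp [Matrix.mul_apply]

theorem isSolutionOperator_monodromy {A : ℝ → Matrix (Fin n) (Fin n) ℝ}
    (hA : ∀ i j, Continuous fun x => A x i j) :
    ∃ U, IsSolutionOperator A U ∧ monodromy A = U 1 := by
  have h := exists_isSolutionOperator hA
  refine ⟨h.choose, h.choose_spec, ?_⟩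
  rw [monodromy, dif_pos h]

/-- Complex and real monodromy matrices agree for real coefficients. -/
theorem IsFundamental.eq_map_monodromy {A : ℝ → Matrix (Fin n) (Fin n) ℝ}
    (hA : ∀ i j, Continuous fun x => A x i j) {U : ℝ → Matrix (Fin n) (Fin n) ℂ}
    (hU : IsFundamental (fun x => (A x).map Complex.ofReal) U) :
    U 1 = (monodromy A).map Complex.ofReal := by
  obtain ⟨W, hW, h1⟩ := isSolutionOperator_monodromy hA
  have hAc : Continuous fun x => (A x).map Complex.ofReal :=
    continuous_matrix_of_entries fun i j => Complex.continuous_ofReal.comp (hA i j)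
  have hWf := hW.isFundamental
  rw [linear_ode_unique_univ hAc hU.2 hWf.2 (hU.1.trans hWf.1.symm), h1]

theorem HasDerivAt.matrix_transpose {U : ℝ → Matrix (Fin n) (Fin n) ℂ}
    {U' : Matrix (Fin n) (Fin n) ℂ} {x : ℝ} (h : HasDerivAt U U' x) :
    HasDerivAt (fun s => (U s)ᵀ) U'ᵀ x :=
  hasDerivAt_matrix_iff.2 fun i j => hasDerivAt_matrix_iff.1 h j i

/-- A Hamiltonian system preserves the symplectic form `J`. -/
theorem IsFundamental.preserves_form {A U : ℝ → Matrix (Fin n) (Fin n) ℂ}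
    (hU : IsFundamental A U) {J : Matrix (Fin n) (Fin n) ℂ}
    (hJ : ∀ x, (A x)ᵀ * J + J * A x = 0) (x : ℝ) : (U x)ᵀ * J * U x = J := by
  have hd : ∀ x, HasDerivAt (fun s => (U s)ᵀ * J * U s) 0 x := by
    intro x
    have h := ((HasDerivAt.matrix_transpose (hU.2 x)).mul_const J).mul (hU.2 x)
    refine h.congr_deriv ?_
    have : (A x * U x)ᵀ * J * U x + (U x)ᵀ * J * (A x * U x) =
        (U x)ᵀ * ((A x)ᵀ * J + J * A x) * U x := by
      simp only [Matrix.transpose_mul]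
      noncomm_ring
    rw [this, hJ]
    simp
  have := is_const_of_deriv_eq_zero (fun x => (hd x).differentiableAt) (fun x => (hd x).deriv) x 0
  rw [this, hU.1]
  simp

end MatrixODE

/-! ### The stability problem as a first order system -/

section Floquet

open Matrix

/-- The system `L₊ p = μ q`, `L₋ q = μ p` with potentials `Wp`, `Wm` and complex `μ`, in first order
form for `(p, p', q, q')`. -/
def coupledSystem (Wp Wm : ℝ → ℝ) (μ : ℂ) (x : ℝ) : Matrix (Fin 4) (Fin 4) ℂ :=
  !![0, 1, 0, 0;
     2 * Wp x, 0, -2 * μ, 0;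
     0, 0, 0, 1;
     -2 * μ, 0, 2 * Wm x, 0]

theorem continuous_coupledSystem {Wp Wm : ℝ → ℝ} (hp : Continuous Wp) (hm : Continuous Wm) (μ : ℂ) :
    Continuous (coupledSystem Wp Wm μ) := by
  refine continuous_matrix_of_entries fun i j => ?_
  fin_cases i <;> fin_cases j <;> simp [coupledSystem] <;> fun_prop

theorem coupledSystem_hamiltonian (Wp Wm : ℝ → ℝ) (μ : ℂ) (x : ℝ) :
    (coupledSystem Wp Wm μ x)ᵀ * symplecticForm + symplecticForm * coupledSystem Wp Wm μ x = 0 := by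
  ext i j
  simp only [Matrix.add_apply, Matrix.mul_apply, Fin.sum_univ_four, transpose_apply]
  fin_cases i <;> fin_cases j <;> simp [symplecticForm, coupledSystem]

variable {V : ℝ → ℝ} {φ : ℝ → ℝ → ℝ} {ω : ℝ → ℝ}

theorem map_stabilitySystem (μ ε x : ℝ) :
    (stabilitySystem V φ ω μ ε x).map Complex.ofReal =
      coupledSystem (potPlus V φ ω ε) (potMinus V φ ω ε) μ x := by
  ext i j
  fin_cases i <;> fin_cases j <;> simp [stabilitySystem, coupledSystem]

theorem schrodinger_eq_of_hasDerivAt {W : ℝ → ℝ} {f g : ℝ → ℂ} {μ : ℂ} {y : ℝ → ℂ}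
    (h1 : ∀ x, HasDerivAt f (g x) x)
    (h2 : ∀ x, HasDerivAt g (2 * W x * f x - 2 * μ * y x) x) (x : ℝ) :
    schrodinger W f x = μ * y x := by
  have e : deriv f = g := funext fun x => (h1 x).deriv
  rw [schrodinger, e, (h2 x).deriv]
  ring

theorem contDiff_two_of_hasDerivAt {f g h : ℝ → ℂ} (h1 : ∀ x, HasDerivAt f (g x) x)
    (h2 : ∀ x, HasDerivAt g (h x) x) (hh : Continuous h) : ContDiff ℝ 2 f := by
  have e1 : deriv f = g := funext fun x => (h1 x).deriv
  have e2 : deriv g = h := funext fun x => (h2 x).deriv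
  have hg : ContDiff ℝ 1 g := contDiff_one_iff_deriv.2 ⟨fun x => (h2 x).differentiableAt, e2 ▸ hh⟩
  rw [show (2 : WithTop ℕ∞) = 1 + 1 by norm_num, contDiff_succ_iff_deriv]
  exact ⟨fun x => (h1 x).differentiableAt, by simp, e1 ▸ hg⟩

/-- An eigenvector of the monodromy matrix for a multiplier on the unit circle generates a Floquet
solution. -/
theorem mem_stabilitySpectrum_of_eigenvector {ε : ℝ} {μ z : ℂ}
    (hp : Continuous (potPlus V φ ω ε)) (hm : Continuous (potMinus V φ ω ε))
    (hpp : Function.Periodic (potPlus V φ ω ε) 1) (hmp : Function.Periodic (potMinus V φ ω ε) 1)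
    {U : ℝ → Matrix (Fin 4) (Fin 4) ℂ}
    (hU : IsFundamental (coupledSystem (potPlus V φ ω ε) (potMinus V φ ω ε) μ) U)
    (hz : ‖z‖ = 1) {v : Fin 4 → ℂ} (hv : v ≠ 0) (hUv : U 1 *ᵥ v = z • v) :
    μ ∈ stabilitySpectrum V φ ω ε := by
  set A := coupledSystem (potPlus V φ ω ε) (potMinus V φ ω ε) μ with hA
  have hAc : Continuous A := continuous_coupledSystem hp hm μ
  have hAp : Function.Periodic A 1 := fun x => by simp only [hA, coupledSystem, hpp x, hmp x]
  set y : Fin 4 → ℝ → ℂ := fun i x => (U x *ᵥ v) i with hy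
  have hyd : ∀ i x, HasDerivAt (y i) ((A x *ᵥ (U x *ᵥ v)) i) x := by
    intro i x
    have h := HasDerivAt.fun_sum (u := Finset.univ) fun j (_ : j ∈ Finset.univ) =>
      (hU.hasDerivAt_entry x i j).mul_const (v j)
    refine h.congr_deriv ?_
    rw [Matrix.mulVec_mulVec]
    simp [Matrix.mulVec, dotProduct, Matrix.mul_apply]
  have hyc : ∀ i, Continuous (y i) := fun i =>
    continuous_iff_continuousAt.2 fun x => (hyd i x).continuousAt
  have h0 : ∀ x, HasDerivAt (y 0) (y 1 x) x := fun x => (hyd 0 x).congr_deriv (by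
    simp [hA, coupledSystem, Matrix.mulVec, dotProduct, Fin.sum_univ_four, hy])
  have h1 : ∀ x, HasDerivAt (y 1) (2 * potPlus V φ ω ε x * y 0 x - 2 * μ * y 2 x) x :=
    fun x => (hyd 1 x).congr_deriv (by
      simp [hA, coupledSystem, Matrix.mulVec, dotProduct, Fin.sum_univ_four, hy]; ring)
  have h2 : ∀ x, HasDerivAt (y 2) (y 3 x) x := fun x => (hyd 2 x).congr_deriv (by
    simp [hA, coupledSystem, Matrix.mulVec, dotProduct, Fin.sum_univ_four, hy])
  have h3 : ∀ x, HasDerivAt (y 3) (2 * potMinus V φ ω ε x * y 2 x - 2 * μ * y 0 x) x :=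
    fun x => (hyd 3 x).congr_deriv (by
      simp [hA, coupledSystem, Matrix.mulVec, dotProduct, Fin.sum_univ_four, hy]; ring)
  have hfl : ∀ i x, y i (x + 1) = z * y i x := by
    intro i x
    have : U (x + 1) *ᵥ v = z • (U x *ᵥ v) := by
      rw [hU.add_one hAc hAp, ← Matrix.mulVec_smul, ← hUv, Matrix.mulVec_mulVec]
    exact congrFun this i
  refine ⟨y 0, y 2, z, contDiff_two_of_hasDerivAt h0 h1 (by have := hyc 0; have := hyc 2; fun_prop),
    contDiff_two_of_hasDerivAt h2 h3 (by have := hyc 0; have := hyc 2; fun_prop), ?_, hz,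
    fun x => ⟨hfl 0 x, hfl 2 x⟩,
    fun x => ⟨schrodinger_eq_of_hasDerivAt h0 h1 x, schrodinger_eq_of_hasDerivAt h2 h3 x⟩⟩
  by_contra hcon
  push Not at hcon
  have e1 : y 1 0 = 0 := by
    have := h0 0
    rw [hcon.1] at this
    exact this.unique (hasDerivAt_const _ _)
  have e3 : y 3 0 = 0 := by
    have := h2 0
    rw [hcon.2] at this
    exact this.unique (hasDerivAt_const _ _)
  have e : ∀ i, y i 0 = v i := fun i => by simp [hy, hU.1]
  apply hv
  funext i
  rw [← e i]
  fin_cases i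
  · exact congrFun hcon.1 0
  · exact e1
  · exact congrFun hcon.2 0
  · exact e3

theorem mem_stabilitySpectrum_of_discriminant {ε : ℝ} {μ : ℂ}
    (hp : Continuous (potPlus V φ ω ε)) (hm : Continuous (potMinus V φ ω ε))
    (hpp : Function.Periodic (potPlus V φ ω ε) 1) (hmp : Function.Periodic (potMinus V φ ω ε) 1)
    {U : ℝ → Matrix (Fin 4) (Fin 4) ℂ}
    (hU : IsFundamental (coupledSystem (potPlus V φ ω ε) (potMinus V φ ω ε) μ) U)
    {K : ℝ} (hK : K ∈ Ioo (-2 : ℝ) 2)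
    (h : (2 * (K : ℂ) - (U 1).trace) ^ 2 = (splitting (U 1) * splitting (U 1)).trace) :
    μ ∈ stabilitySpectrum V φ ω ε := by
  obtain ⟨z, v, hz, hv, hUv⟩ := exists_multiplier
    (hU.preserves_form (coupledSystem_hamiltonian _ _ μ) 1) hK h
  exact mem_stabilitySpectrum_of_eigenvector hp hm hpp hmp hU hz hv hUv

end Floquet

/-! ### First variation of the monodromy matrix -/

section Variation

variable {R : Type*} [NormedRing R] [NormedAlgebra ℂ R]

/-- The first variation `y` of the fundamental solution under `a ↦ a + τ b`, extended to the line by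
constants outside `[-1, 1]`. -/
noncomputable def variation (a b : C(Icc (-1 : ℝ) 1, R)) (x : ℝ) : R :=
  fderiv ℂ propagator a b (projIcc (-1) 1 (by norm_num) x)

theorem continuous_variation (a b : C(Icc (-1 : ℝ) 1, R)) : Continuous (variation a b) :=
  (fderiv ℂ propagator a b).continuous.comp continuous_projIcc

variable [CompleteSpace R]

theorem variation_eq_integral (a b : C(Icc (-1 : ℝ) 1, R)) (x : Icc (-1 : ℝ) 1) :
    variation a b x = ∫ s in (0 : ℝ)..x, (b * propagator a + a * fderiv ℂ propagator a b)
      (projIcc (-1) 1 (by norm_num) s) := by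
  rw [← primitive_apply, map_add, ← volterra_apply, ← volterra_apply, ← fderiv_propagator_apply,
    variation, projIcc_val]

theorem variation_zero (a b : C(Icc (-1 : ℝ) 1, R)) : variation a b 0 = 0 := by
  have := variation_eq_integral a b ⟨0, by norm_num⟩
  simpa using this

theorem hasDerivAt_variation (a b : C(Icc (-1 : ℝ) 1, R)) {A U : ℝ → R} {B : R}
    (hA : Continuous A) (hU : IsFundamental A U) (ha : ∀ t, a t = A t) (hb : ∀ t, b t = B)
    {x : ℝ} (hx : x ∈ Ioo (-1 : ℝ) 1) :
    HasDerivAt (variation a b) (B * U x + A x * variation a b x) x := by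
  set f := b * propagator a + a * fderiv ℂ propagator a b with hf
  have hc : Continuous fun s : ℝ => f (projIcc (-1) 1 (by norm_num) s) :=
    f.continuous.comp continuous_projIcc
  have h := intervalIntegral.integral_hasDerivAt_right (hc.intervalIntegrable 0 x)
    (hc.stronglyMeasurableAtFilter _ _) hc.continuousAt
  have hval : f (projIcc (-1) 1 (by norm_num) x) = B * U x + A x * variation a b x := by
    have hxI := Ioo_subset_Icc_self hx
    rw [variation, projIcc_of_mem _ hxI, hf, ContinuousMap.add_apply, ContinuousMap.mul_apply,
      ContinuousMap.mul_apply, ha, hb, ← hU.eq_propagator hA ha]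
  rw [hval] at h
  refine h.congr_of_eventuallyEq ?_
  filter_upwards [Ioo_mem_nhds hx.1 hx.2] with s hs
  exact variation_eq_integral a b ⟨s, Ioo_subset_Icc_self hs⟩

/-- The monodromy matrix of `y' = (A₀ + μ B) y` is complex differentiable in `μ`. -/
theorem hasDerivAt_monodromy {A₀ : ℝ → R} {B : R} (hA : Continuous A₀) {U : ℂ → ℝ → R}
    (hU : ∀ μ, IsFundamental (fun x => A₀ x + μ • B) (U μ)) (μ : ℂ)
    {a b : C(Icc (-1 : ℝ) 1, R)} (ha : ∀ t, a t = A₀ t + μ • B) (hb : ∀ t, b t = B) :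
    HasDerivAt (fun ν => U ν 1) (variation a b 1) μ := by
  have h1 : (1 : ℝ) ∈ Icc (-1 : ℝ) 1 := by norm_num
  have hev : (fun ν => U ν 1) =
      fun ν => ContinuousMap.evalCLM ℂ ⟨1, h1⟩ (propagator (a + (ν - μ) • b)) := by
    funext ν
    refine (hU ν).eq_propagator (by fun_prop) (fun t => ?_) ⟨1, h1⟩
    rw [ContinuousMap.add_apply, ContinuousMap.smul_apply, ha, hb]
    module
  rw [hev]
  have hlin : HasDerivAt (fun ν : ℂ => a + (ν - μ) • b) b μ := by
    simpa using (((hasDerivAt_id μ).sub_const μ).smul_const b).const_add a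
  have hp : HasFDerivAt propagator (fderiv ℂ propagator a) (a + (μ - μ) • b) := by
    have e : a + (μ - μ) • b = a := by ext t; simp
    rw [e]
    exact (contDiff_propagator.differentiable (by norm_num) a).hasFDerivAt
  have h := (ContinuousMap.evalCLM ℂ (⟨1, h1⟩ : Icc (-1 : ℝ) 1)).hasFDerivAt.comp_hasDerivAt μ
    (hp.comp_hasDerivAt μ hlin)
  refine h.congr_deriv ?_
  rw [variation, projIcc_of_mem _ h1]
  rfl

end Variation

/-! ### The Floquet discriminant of Hill's equation -/

section Hill

open Matrix

/-- The trace of the first variation of an elliptic Hill monodromy matrix does not vanish: by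
variation of constants it is the integral of a definite quadratic form in the two fundamental
solutions `u`, `v`. Here `a`, `b` are the variations of `u`, `v`, and `c`, `d` their derivatives. -/
theorem hill_trace_variation_ne_zero {w u v p q a b c d : ℝ → ℝ}
    (hu : ∀ x, HasDerivAt u (p x) x) (hv : ∀ x, HasDerivAt v (q x) x)
    (hp : ∀ x, HasDerivAt p (w x * u x) x) (hq : ∀ x, HasDerivAt q (w x * v x) x)
    (hu0 : u 0 = 1) (hv0 : v 0 = 0) (hp0 : p 0 = 0) (hq0 : q 0 = 1)
    (hac : Continuous a) (hbc : Continuous b) (hcc : Continuous c) (hdc : Continuous d)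
    (ha : ∀ x ∈ Ioo (0 : ℝ) 1, HasDerivAt a (c x) x)
    (hb : ∀ x ∈ Ioo (0 : ℝ) 1, HasDerivAt b (d x) x)
    (hc : ∀ x ∈ Ioo (0 : ℝ) 1, HasDerivAt c (w x * a x - 2 * u x) x)
    (hd : ∀ x ∈ Ioo (0 : ℝ) 1, HasDerivAt d (w x * b x - 2 * v x) x)
    (ha0 : a 0 = 0) (hb0 : b 0 = 0) (hc0 : c 0 = 0) (hd0 : d 0 = 0)
    (hk : u 1 + q 1 ∈ Ioo (-2 : ℝ) 2) : a 1 + d 1 ≠ 0 := by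
  have hdet : ∀ x, u x * q x - v x * p x = 1 := by
    intro x
    have hd : ∀ x, HasDerivAt (fun x => u x * q x - v x * p x) 0 x := fun x =>
      (((hu x).mul (hq x)).sub ((hv x).mul (hp x))).congr_deriv (by ring)
    have := is_const_of_deriv_eq_zero (fun x => (hd x).differentiableAt)
      (fun x => (hd x).deriv) x 0
    simpa [hu0, hv0, hp0, hq0] using this
  have hdet1 := hdet 1
  set α := u 1
  set β := v 1
  set γ := p 1
  set δ := q 1
  have hk2 : 0 < 4 - (α + δ) ^ 2 := by nlinarith [hk.1, hk.2]
  -- if `β = 0` then `α δ = 1`, which forces `|α + δ| ≥ 2`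
  have hβ : β ≠ 0 := by
    intro h0
    rw [h0] at hdet1
    nlinarith [sq_nonneg (α - δ)]
  -- `g = β Tr (U(1) U⁻¹ y)` for the fundamental matrix `U` and its variation `y`
  set g : ℝ → ℝ := fun x => β * (β * (u x * c x - p x * a x) - α * (v x * c x - q x * a x) +
    δ * (u x * d x - p x * b x) - γ * (v x * d x - q x * b x)) with hg
  have hgd : ∀ x ∈ Ioo (0 : ℝ) 1, HasDerivAt g
      (-2 * ((β * u x + (δ - α) / 2 * v x) ^ 2 + (4 - (α + δ) ^ 2) / 4 * v x ^ 2)) x := by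
    intro x hx
    have h := ((((((hu x).mul (hc x hx)).sub ((hp x).mul (ha x hx))).const_mul β).sub
      ((((hv x).mul (hc x hx)).sub ((hq x).mul (ha x hx))).const_mul α)).add
      ((((hu x).mul (hd x hx)).sub ((hp x).mul (hb x hx))).const_mul δ)).sub
      ((((hv x).mul (hd x hx)).sub ((hq x).mul (hb x hx))).const_mul γ)
    refine (h.const_mul β).congr_deriv ?_
    linear_combination (-2 * v x ^ 2) * hdet1
  have huc : Continuous u := continuous_iff_continuousAt.2 fun x => (hu x).continuousAt
  have hvc : Continuous v := continuous_iff_continuousAt.2 fun x => (hv x).continuousAt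
  have hpc : Continuous p := continuous_iff_continuousAt.2 fun x => (hp x).continuousAt
  have hqc : Continuous q := continuous_iff_continuousAt.2 fun x => (hq x).continuousAt
  have hanti : StrictAntiOn g (Icc 0 1) := by
    refine strictAntiOn_of_deriv_neg (convex_Icc 0 1) (by fun_prop) fun x hx => ?_
    rw [interior_Icc] at hx
    rw [(hgd x hx).deriv]
    have hpos : 0 < (β * u x + (δ - α) / 2 * v x) ^ 2 + (4 - (α + δ) ^ 2) / 4 * v x ^ 2 := by
      rcases eq_or_ne (v x) 0 with h0 | h0
      · have hux : u x ≠ 0 := by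
          intro hux
          have := hdet x
          rw [hux, h0] at this
          simp at this
        have e : (β * u x + (δ - α) / 2 * v x) ^ 2 + (4 - (α + δ) ^ 2) / 4 * v x ^ 2 =
            (β * u x) ^ 2 := by rw [h0]; ring
        rw [e]
        positivity
      · positivity
    linarith
  have h01 := hanti (left_mem_Icc.2 zero_le_one) (right_mem_Icc.2 zero_le_one) zero_lt_one
  intro hsum
  have h1 : g 1 = β * ((a 1 + d 1) * (α * δ - β * γ)) := by
    simp only [hg]
    ring
  have h0 : g 0 = 0 := by simp [hg, ha0, hb0, hc0, hd0]
  rw [h1, h0, hsum] at h01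
  simp at h01

/-- Hill's equation `-f''/2 + W f = μ f` as a first order system, for complex `μ`. -/
def complexHillSystem (W : ℝ → ℝ) (μ : ℂ) (x : ℝ) : Matrix (Fin 2) (Fin 2) ℂ :=
  !![0, 1;
     2 * (W x - μ), 0]

theorem continuous_complexHillSystem {W : ℝ → ℝ} (hW : Continuous W) (μ : ℂ) :
    Continuous (complexHillSystem W μ) := by
  refine continuous_matrix_of_entries fun i j => ?_
  fin_cases i <;> fin_cases j <;> simp [complexHillSystem] <;> fun_prop

theorem map_hillSystem (W : ℝ → ℝ) (μ x : ℝ) :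
    (hillSystem W μ x).map Complex.ofReal = complexHillSystem W μ x := by
  ext i j
  fin_cases i <;> fin_cases j <;> simp [hillSystem, complexHillSystem]

theorem complexHillSystem_eq_add_smul (W : ℝ → ℝ) (μ : ℂ) (x : ℝ) :
    complexHillSystem W μ x = complexHillSystem W 0 x + μ • !![0, 0; -2, 0] := by
  ext i j
  fin_cases i <;> fin_cases j <;> simp [complexHillSystem]
  ring

theorem continuous_hillSystem_entry {W : ℝ → ℝ} (hW : Continuous W) (μ : ℝ) (i j : Fin 2) :
    Continuous fun x => hillSystem W μ x i j := by
  fin_cases i <;> fin_cases j <;> simp [hillSystem] <;> fun_prop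

theorem IsFundamental.trace_hill {W : ℝ → ℝ} (hW : Continuous W) {μ : ℝ}
    {U : ℝ → Matrix (Fin 2) (Fin 2) ℂ} (hU : IsFundamental (complexHillSystem W μ) U) :
    (U 1).trace = (monodromy (hillSystem W μ)).trace := by
  have h : IsFundamental (fun x => (hillSystem W μ x).map Complex.ofReal) U := by
    simpa only [map_hillSystem] using hU
  rw [h.eq_map_monodromy (continuous_hillSystem_entry hW μ)]
  simp [Matrix.trace]

/-- The Floquet discriminant is differentiable, and its derivative does not vanish inside the
bands. -/
theorem hill_discriminant_deriv {W : ℝ → ℝ} (hW : Continuous W) (μ : ℝ) :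
    DifferentiableAt ℝ (fun μ => (monodromy (hillSystem W μ)).trace) μ ∧
    ((monodromy (hillSystem W μ)).trace ∈ Ioo (-2 : ℝ) 2 →
      deriv (fun μ => (monodromy (hillSystem W μ)).trace) μ ≠ 0) := by
  set B : Matrix (Fin 2) (Fin 2) ℂ := !![0, 0; -2, 0] with hB
  choose U hU using fun μ => exists_isFundamental (continuous_complexHillSystem hW μ)
  have hU' : ∀ μ, IsFundamental (fun x => complexHillSystem W 0 x + μ • B) (U μ) := by
    intro ν
    have := hU ν
    rwa [funext fun x => complexHillSystem_eq_add_smul W ν x] at this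
  set a : C(Icc (-1 : ℝ) 1, Matrix (Fin 2) (Fin 2) ℂ) :=
    ⟨fun t => complexHillSystem W μ t,
      (continuous_complexHillSystem hW μ).comp continuous_subtype_val⟩
  set b : C(Icc (-1 : ℝ) 1, Matrix (Fin 2) (Fin 2) ℂ) := ContinuousMap.const _ B
  have hder := hasDerivAt_monodromy (continuous_complexHillSystem hW 0) hU' (μ : ℂ) (a := a)
    (b := b) (fun t => complexHillSystem_eq_add_smul W μ t) (fun t => rfl)
  set y := variation a b
  have htr : HasDerivAt (fun ν : ℂ => (U ν 1).trace) (y 1).trace (μ : ℂ) :=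
    traceCLM.hasFDerivAt.comp_hasDerivAt (μ : ℂ) hder
  have hreal := htr.real_of_complex
  have hfun : (fun x : ℝ => ((U x 1).trace).re) = fun μ => (monodromy (hillSystem W μ)).trace := by
    funext ν
    rw [(hU ν).trace_hill hW, Complex.ofReal_re]
  rw [hfun] at hreal
  refine ⟨hreal.differentiableAt, fun hk => ?_⟩
  rw [hreal.deriv]
  obtain ⟨S, hS, hS1⟩ := isSolutionOperator_monodromy (continuous_hillSystem_entry hW μ)
  have hSf := hS.isFundamental
  have hSU : (fun x => (S x).map Complex.ofReal) = U μ := by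
    refine linear_ode_unique_univ (continuous_complexHillSystem hW μ) ?_ (hU μ).2
      (hSf.1.trans (hU μ).1.symm)
    intro x
    have := hSf.2 x
    simp only [map_hillSystem] at this
    exact this
  have hyd : ∀ x ∈ Ioo (0 : ℝ) 1, ∀ i j,
      HasDerivAt (fun s => (y s i j).re)
        ((B * U μ x + complexHillSystem W μ x * y x) i j).re x := by
    intro x hx i j
    have h := hasDerivAt_variation a b (continuous_complexHillSystem hW μ) (hU μ)
      (fun t => rfl) (fun t => rfl) (x := x) ⟨by linarith [hx.1], hx.2⟩
    exact Complex.reCLM.hasFDerivAt.comp_hasDerivAt x (hasDerivAt_matrix_iff.1 h i j)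
  have hyc : ∀ i j, Continuous fun s => (y s i j).re := fun i j =>
    Complex.continuous_re.comp ((entryCLM i j).continuous.comp (continuous_variation a b))
  have hy0 : y 0 = 0 := variation_zero a b
  have hSx : ∀ x, U μ x = (S x).map Complex.ofReal := fun x => (congrFun hSU x).symm
  have key := hill_trace_variation_ne_zero (w := fun x => 2 * (W x - μ))
    (u := fun x => S x 0 0) (v := fun x => S x 0 1) (p := fun x => S x 1 0) (q := fun x => S x 1 1)
    (a := fun x => (y x 0 0).re) (b := fun x => (y x 0 1).re) (c := fun x => (y x 1 0).re)
    (d := fun x => (y x 1 1).re)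
    (fun x => (hS.2 x 0 0).congr_deriv (by simp [hillSystem, Matrix.mul_apply]))
    (fun x => (hS.2 x 0 1).congr_deriv (by simp [hillSystem, Matrix.mul_apply]))
    (fun x => (hS.2 x 1 0).congr_deriv (by simp [hillSystem, Matrix.mul_apply]))
    (fun x => (hS.2 x 1 1).congr_deriv (by simp [hillSystem, Matrix.mul_apply]))
    (by simp [hS.1]) (by simp [hS.1]) (by simp [hS.1]) (by simp [hS.1])
    (hyc 0 0) (hyc 0 1) (hyc 1 0) (hyc 1 1)
    (fun x hx => (hyd x hx 0 0).congr_deriv (by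
      simp only [Matrix.add_apply, Matrix.mul_apply, Fin.sum_univ_two]
      simp [complexHillSystem, hB, hSx]))
    (fun x hx => (hyd x hx 0 1).congr_deriv (by
      simp only [Matrix.add_apply, Matrix.mul_apply, Fin.sum_univ_two]
      simp [complexHillSystem, hB, hSx]))
    (fun x hx => (hyd x hx 1 0).congr_deriv (by
      simp only [Matrix.add_apply, Matrix.mul_apply, Fin.sum_univ_two]
      simp [complexHillSystem, hB, hSx]; ring))
    (fun x hx => (hyd x hx 1 1).congr_deriv (by
      simp only [Matrix.add_apply, Matrix.mul_apply, Fin.sum_univ_two]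
      simp [complexHillSystem, hB, hSx]; ring))
    (by simp [hy0]) (by simp [hy0]) (by simp [hy0]) (by simp [hy0])
    (by rw [hS1, Matrix.trace_fin_two] at hk; exact hk)
  rw [Matrix.trace_fin_two, Complex.add_re]
  exact key

end Hill

/-! ### Decoupling for equal potentials -/

section Decoupling

open Matrix

/-- The propagation matrix for `(p, p', q, q')` when `p + q` is propagated by `P` and `p - q` is
propagated by `Q`. -/
noncomputable def sumDiff (P Q : Matrix (Fin 2) (Fin 2) ℂ) : Matrix (Fin 4) (Fin 4) ℂ :=
  !![(P 0 0 + Q 0 0) / 2, (P 0 1 + Q 0 1) / 2, (P 0 0 - Q 0 0) / 2, (P 0 1 - Q 0 1) / 2;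
     (P 1 0 + Q 1 0) / 2, (P 1 1 + Q 1 1) / 2, (P 1 0 - Q 1 0) / 2, (P 1 1 - Q 1 1) / 2;
     (P 0 0 - Q 0 0) / 2, (P 0 1 - Q 0 1) / 2, (P 0 0 + Q 0 0) / 2, (P 0 1 + Q 0 1) / 2;
     (P 1 0 - Q 1 0) / 2, (P 1 1 - Q 1 1) / 2, (P 1 0 + Q 1 0) / 2, (P 1 1 + Q 1 1) / 2]

/-- The exchange of `(p, p')` and `(q, q')`. -/
def exchange : Matrix (Fin 4) (Fin 4) ℂ :=
  !![0, 0, 1, 0;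
     0, 0, 0, 1;
     1, 0, 0, 0;
     0, 1, 0, 0]

theorem trace_exchange_mul_self : (exchange * exchange).trace = 4 := by
  simp [exchange, Matrix.trace, Fin.sum_univ_four]
  norm_num

theorem trace_sumDiff (P Q : Matrix (Fin 2) (Fin 2) ℂ) :
    (sumDiff P Q).trace = P.trace + Q.trace := by
  simp [sumDiff, Matrix.trace, Fin.sum_univ_four]
  ring

theorem splitting_sumDiff (P Q : Matrix (Fin 2) (Fin 2) ℂ) :
    splitting (sumDiff P Q) = ((P.trace - Q.trace) / 2) • exchange := by
  rw [splitting_apply, sympAdjoint_eq, trace_sumDiff]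
  ext i j
  fin_cases i <;> fin_cases j <;>
    simp [sumDiff, exchange, Matrix.trace_fin_two] <;> ring

/-- For equal potentials the stability problem decouples into Hill's equations for `p + q`, with
parameter `μ`, and for `p - q`, with parameter `-μ`. -/
theorem isFundamental_sumDiff {W : ℝ → ℝ} {μ : ℂ} {P Q : ℝ → Matrix (Fin 2) (Fin 2) ℂ}
    (hP : IsFundamental (complexHillSystem W μ) P)
    (hQ : IsFundamental (complexHillSystem W (-μ)) Q) :
    IsFundamental (coupledSystem W W μ) (fun x => sumDiff (P x) (Q x)) := by
  refine ⟨?_, fun x => hasDerivAt_matrix_iff.2 fun i j => ?_⟩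
  · simp only [hP.1, hQ.1]
    ext i j
    fin_cases i <;> fin_cases j <;> simp [sumDiff]
  · change HasDerivAt _ (∑ k, coupledSystem W W μ x i k * sumDiff (P x) (Q x) k j) x
    have h : ∀ j : Fin 2, (HasDerivAt (fun s => P s 0 j) (P x 1 j) x ∧
        HasDerivAt (fun s => P s 1 j) (2 * (W x - μ) * P x 0 j) x) ∧
        (HasDerivAt (fun s => Q s 0 j) (Q x 1 j) x ∧
        HasDerivAt (fun s => Q s 1 j) (2 * (W x + μ) * Q x 0 j) x) := fun j =>
      ⟨⟨(hP.hasDerivAt_entry x 0 j).congr_deriv (by simp [complexHillSystem]),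
        (hP.hasDerivAt_entry x 1 j).congr_deriv (by simp [complexHillSystem])⟩,
       ⟨(hQ.hasDerivAt_entry x 0 j).congr_deriv (by simp [complexHillSystem]),
        (hQ.hasDerivAt_entry x 1 j).congr_deriv (by simp [complexHillSystem])⟩⟩
    have key : ∀ (f g : ℝ → ℂ) (f' g' : ℂ), HasDerivAt f f' x → HasDerivAt g g' x →
        HasDerivAt (fun s => (f s + g s) / 2) ((f' + g') / 2) x ∧
        HasDerivAt (fun s => (f s - g s) / 2) ((f' - g') / 2) x := fun f g f' g' hf hg =>
      ⟨(hf.add hg).div_const 2, (hf.sub hg).div_const 2⟩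
    have k0 := fun j => key _ _ _ _ (h j).1.1 (h j).2.1
    have k1 := fun j => key _ _ _ _ (h j).1.2 (h j).2.2
    rw [Fin.sum_univ_four]
    fin_cases i <;> fin_cases j
    · exact (k0 0).1.congr_deriv (by simp [coupledSystem, sumDiff])
    · exact (k0 1).1.congr_deriv (by simp [coupledSystem, sumDiff])
    · exact (k0 0).2.congr_deriv (by simp [coupledSystem, sumDiff])
    · exact (k0 1).2.congr_deriv (by simp [coupledSystem, sumDiff])
    · exact (k1 0).1.congr_deriv (by simp [coupledSystem, sumDiff]; ring)
    · exact (k1 1).1.congr_deriv (by simp [coupledSystem, sumDiff]; ring)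
    · exact (k1 0).2.congr_deriv (by simp [coupledSystem, sumDiff]; ring)
    · exact (k1 1).2.congr_deriv (by simp [coupledSystem, sumDiff]; ring)
    · exact (k0 0).2.congr_deriv (by simp [coupledSystem, sumDiff])
    · exact (k0 1).2.congr_deriv (by simp [coupledSystem, sumDiff])
    · exact (k0 0).1.congr_deriv (by simp [coupledSystem, sumDiff])
    · exact (k0 1).1.congr_deriv (by simp [coupledSystem, sumDiff])
    · exact (k1 0).2.congr_deriv (by simp [coupledSystem, sumDiff]; ring)
    · exact (k1 1).2.congr_deriv (by simp [coupledSystem, sumDiff]; ring)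
    · exact (k1 0).1.congr_deriv (by simp [coupledSystem, sumDiff]; ring)
    · exact (k1 1).1.congr_deriv (by simp [coupledSystem, sumDiff]; ring)

end Decoupling

/-! ### Smooth curves of continuous functions -/

section Curves

/-- A family of functions that is jointly `C¹` is a `C¹` curve in the Banach space `C([-1, 1])`. -/
theorem contDiffAt_curve {f : ℝ → ℝ → ℝ} {δ : ℝ}
    (hf : ContDiffOn ℝ 1 (fun z : ℝ × ℝ => f z.1 z.2) (univ ×ˢ Ioo (-δ) δ))
    {Φ : ℝ → C(Icc (-1 : ℝ) 1, ℝ)} {δ' : ℝ} (hδ' : 0 < δ') (hδδ' : δ' < δ)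
    (hΦ : ∀ ε, |ε| < δ' → ∀ t, Φ ε t = f t ε) : ContDiffAt ℝ 1 Φ 0 := by
  have hopen : IsOpen (univ ×ˢ Ioo (-δ) δ : Set (ℝ × ℝ)) := isOpen_univ.prod isOpen_Ioo
  set g : ℝ × ℝ → ℝ := fun z => fderiv ℝ (fun z : ℝ × ℝ => f z.1 z.2) z (0, 1)
  have hgc : ContinuousOn g (univ ×ˢ Ioo (-δ) δ) :=
    (hf.continuousOn_fderiv_of_isOpen hopen le_rfl).clm_apply continuousOn_const
  have hgd : ∀ x ε, ε ∈ Ioo (-δ) δ → HasDerivAt (fun e => f x e) (g (x, ε)) ε := by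
    intro x ε hε
    have h1 : HasFDerivAt (fun z : ℝ × ℝ => f z.1 z.2) _ (x, ε) :=
      ((hf.differentiableOn (by norm_num)).differentiableAt
        (hopen.mem_nhds ⟨mem_univ x, hε⟩)).hasFDerivAt
    have h2 : HasDerivAt (fun e : ℝ => (x, e)) ((0 : ℝ), (1 : ℝ)) ε :=
      (hasDerivAt_const ε x).prodMk (hasDerivAt_id ε)
    exact h1.comp_hasDerivAt ε h2
  -- the curve of `ε`-derivatives, with `ε` clamped to `[-δ', δ']` to make it continuous everywhere
  have hle : -δ' ≤ δ' := by linarith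
  have hclamp : ∀ ε, (projIcc (-δ') δ' hle ε : ℝ) ∈ Ioo (-δ) δ := fun ε =>
    ⟨by linarith [(projIcc (-δ') δ' hle ε).2.1], by linarith [(projIcc (-δ') δ' hle ε).2.2]⟩
  have hjoint : Continuous fun z : ℝ × Icc (-1 : ℝ) 1 =>
      g ((z.2 : ℝ), (projIcc (-δ') δ' hle z.1 : ℝ)) := by
    refine hgc.comp_continuous ?_ fun z => ⟨mem_univ _, hclamp z.1⟩
    exact (continuous_subtype_val.comp continuous_snd).prodMk
      (continuous_subtype_val.comp (continuous_projIcc.comp continuous_fst))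
  set G : C(ℝ, C(Icc (-1 : ℝ) 1, ℝ)) := ContinuousMap.curry ⟨_, hjoint⟩ with hG
  have hGt : ∀ ε, |ε| < δ' → ∀ t, G ε t = g ((t : ℝ), ε) := by
    intro ε hε t
    have : projIcc (-δ') δ' hle ε = (⟨ε, (abs_le.1 hε.le)⟩ : Icc (-δ') δ') :=
      projIcc_of_mem hle (abs_le.1 hε.le)
    simp [hG, this]
  have hint : ∀ ε, |ε| < δ' → Φ ε = Φ 0 + ∫ s in (0 : ℝ)..ε, G s := by
    intro ε hε
    ext t
    have hev := (ContinuousMap.evalCLM ℝ t).intervalIntegral_comp_comm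
      (G.continuous.intervalIntegrable (0 : ℝ) ε (μ := volume))
    simp only [ContinuousMap.evalCLM_apply] at hev
    rw [ContinuousMap.add_apply, ← hev, hΦ ε hε, hΦ 0 (by simpa using hδ')]
    have hmem : ∀ s ∈ uIcc 0 ε, |s| < δ' := by
      intro s hs
      have h1 := abs_sub_left_of_mem_uIcc hs
      simp only [sub_zero] at h1
      exact h1.trans_lt hε
    have h1 : ∫ s in (0 : ℝ)..ε, G s t = ∫ s in (0 : ℝ)..ε, g ((t : ℝ), s) :=
      intervalIntegral.integral_congr fun s hs => hGt s (hmem s hs) t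
    have h2 := intervalIntegral.integral_eq_sub_of_hasDerivAt (a := 0) (b := ε)
      (f := fun e => f t e) (f' := fun e => g ((t : ℝ), e))
      (fun s hs => hgd t s (by
        have := abs_lt.1 (hmem s hs)
        exact ⟨by linarith [this.1], by linarith [this.2]⟩))
      (ContinuousOn.intervalIntegrable (hgc.comp (by fun_prop) fun s hs => ⟨mem_univ _, by
        have := abs_lt.1 (hmem s hs)
        exact ⟨by linarith [this.1], by linarith [this.2]⟩⟩))
    rw [h1, h2]
    ring
  have hΨ : ContDiff ℝ 1 fun ε => Φ 0 + ∫ s in (0 : ℝ)..ε, G s := by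
    have hd : ∀ ε, HasDerivAt (fun ε => Φ 0 + ∫ s in (0 : ℝ)..ε, G s) (G ε) ε := fun ε =>
      (intervalIntegral.integral_hasDerivAt_right (G.continuous.intervalIntegrable _ _)
        (G.continuous.stronglyMeasurableAtFilter _ _) G.continuous.continuousAt).const_add _
    refine contDiff_one_iff_deriv.2 ⟨fun ε => (hd ε).differentiableAt, ?_⟩
    rw [funext fun ε => (hd ε).deriv]
    exact G.continuous
  refine hΨ.contDiffAt.congr_of_eventuallyEq ?_
  have : ∀ᶠ ε in 𝓝 (0 : ℝ), |ε| < δ' :=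
    continuous_abs.continuousAt.eventually (gt_mem_nhds (by simpa using hδ'))
  filter_upwards [this] with ε hε using hint ε hε

end Curves

/-! ### Propagators of affine families of coefficients -/

section AffineFamily

variable {R : Type*} [NormedRing R] [NormedAlgebra ℂ R]

/-- The coefficient `A₀ + μ B + f(ε) E - g(ε) F` as an element of the Banach space of continuous
functions on `[-1, 1]`; of the terms with parameters, only `f(ε)` depends on `x`. -/
noncomputable def coeffFamily (A₀ : C(Icc (-1 : ℝ) 1, R)) (B E F : R)
    (f : ℝ → C(Icc (-1 : ℝ) 1, ℝ)) (g : ℝ → ℝ) (z : ℂ × ℝ) : C(Icc (-1 : ℝ) 1, R) :=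
  A₀ + z.1 • ContinuousMap.const _ B +
    ContinuousLinearMap.compLeftContinuous ℝ (Icc (-1 : ℝ) 1)
      (ContinuousLinearMap.toSpanSingleton ℝ E) (f z.2) -
    g z.2 • ContinuousMap.const _ F

theorem coeffFamily_apply (A₀ : C(Icc (-1 : ℝ) 1, R)) (B E F : R)
    (f : ℝ → C(Icc (-1 : ℝ) 1, ℝ)) (g : ℝ → ℝ) (z : ℂ × ℝ) (t : Icc (-1 : ℝ) 1) :
    coeffFamily A₀ B E F f g z t =
      A₀ t + z.1 • B + ((f z.2 t : ℝ) : ℂ) • E - ((g z.2 : ℝ) : ℂ) • F := rfl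

theorem contDiffAt_propagator_coeffFamily [CompleteSpace R] (A₀ : C(Icc (-1 : ℝ) 1, R)) (B E F : R)
    {f : ℝ → C(Icc (-1 : ℝ) 1, ℝ)} {g : ℝ → ℝ} (hf : ContDiffAt ℝ 1 f 0) (hg : ContDiffAt ℝ 1 g 0)
    (μ₀ : ℂ) (t : Icc (-1 : ℝ) 1) :
    ContDiffAt ℝ 1 (fun z => propagator (coeffFamily A₀ B E F f g z) t) (μ₀, 0) := by
  have hf2 : ContDiffAt ℝ 1 (fun z : ℂ × ℝ => f z.2) (μ₀, 0) :=
    ContDiffAt.comp (μ₀, (0 : ℝ)) (f := fun z : ℂ × ℝ => z.2) hf contDiffAt_snd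
  have hg2 : ContDiffAt ℝ 1 (fun z : ℂ × ℝ => g z.2) (μ₀, 0) :=
    ContDiffAt.comp (μ₀, (0 : ℝ)) (f := fun z : ℂ × ℝ => z.2) hg contDiffAt_snd
  have h1 : ContDiffAt ℝ 1
      (fun z : ℂ × ℝ => z.1 • (ContinuousMap.const (Icc (-1 : ℝ) 1) B)) (μ₀, 0) :=
    contDiffAt_fst.smul contDiffAt_const
  have h3 := (ContinuousLinearMap.compLeftContinuous ℝ (Icc (-1 : ℝ) 1)
      (ContinuousLinearMap.toSpanSingleton ℝ E)).contDiff.contDiffAt.comp (n := 1) _ hf2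
  have ha : ContDiffAt ℝ 1 (coeffFamily A₀ B E F f g) (μ₀, 0) :=
    ((contDiffAt_const.add h1).add h3).sub (hg2.smul contDiffAt_const)
  exact (((ContinuousMap.evalCLM ℂ t).contDiff.comp
      contDiff_propagator).restrict_scalars ℝ).contDiffAt.comp _ ha

end AffineFamily

/-! ### The monodromy matrix along the family of standing waves -/

section Family

open Matrix

variable {V : ℝ → ℝ} {φ : ℝ → ℝ → ℝ} {ω : ℝ → ℝ} {δ : ℝ}

theorem IsStandingWaveFamily.continuous_profile (h : IsStandingWaveFamily V φ ω δ) {ε : ℝ}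
    (hε : |ε| < δ) : Continuous fun x => φ x ε :=
  h.contDiff_profile.continuousOn.comp_continuous (by fun_prop : Continuous fun x : ℝ => (x, ε))
    fun x => ⟨mem_univ x, abs_lt.1 hε⟩

theorem IsStandingWaveFamily.periodic_sq (h : IsStandingWaveFamily V φ ω δ) {ε : ℝ}
    (hε : |ε| < δ) (x : ℝ) : φ (x + 1) ε ^ 2 = φ x ε ^ 2 := by
  rcases h.periodic_or_antiperiodic with hp | hp
  · rw [hp ε (abs_lt.1 hε)]
  · rw [hp ε (abs_lt.1 hε), neg_sq]

theorem IsStandingWaveFamily.continuous_potPlus (h : IsStandingWaveFamily V φ ω δ)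
    (hV : Continuous V) {ε : ℝ} (hε : |ε| < δ) : Continuous (potPlus V φ ω ε) := by
  have := h.continuous_profile hε
  unfold potPlus
  fun_prop

theorem IsStandingWaveFamily.continuous_potMinus (h : IsStandingWaveFamily V φ ω δ)
    (hV : Continuous V) {ε : ℝ} (hε : |ε| < δ) : Continuous (potMinus V φ ω ε) := by
  have := h.continuous_profile hε
  unfold potMinus
  fun_prop

open Classical in
/-- The monodromy matrix `M(μ, ε)` of the stability problem for complex `μ`. The fundamental
solution exists and is unique for continuous potentials; the other branch is not used. -/
noncomputable def complexMonodromy (V : ℝ → ℝ) (φ : ℝ → ℝ → ℝ) (ω : ℝ → ℝ) (z : ℂ × ℝ) :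
    Matrix (Fin 4) (Fin 4) ℂ :=
  if h : ∃ U, IsFundamental (coupledSystem (potPlus V φ ω z.2) (potMinus V φ ω z.2) z.1) U then
    h.choose 1 else 1

theorem IsFundamental.eq_complexMonodromy (hp : IsStandingWaveFamily V φ ω δ) (hV : Continuous V)
    {z : ℂ × ℝ} (hz : |z.2| < δ) {U : ℝ → Matrix (Fin 4) (Fin 4) ℂ}
    (hU : IsFundamental (coupledSystem (potPlus V φ ω z.2) (potMinus V φ ω z.2) z.1) U) :
    U 1 = complexMonodromy V φ ω z := by
  have h : ∃ U, IsFundamental (coupledSystem (potPlus V φ ω z.2) (potMinus V φ ω z.2) z.1) U :=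
    ⟨U, hU⟩
  rw [complexMonodromy, dif_pos h]
  have hs := h.choose_spec
  rw [linear_ode_unique_univ (continuous_coupledSystem (hp.continuous_potPlus hV hz)
    (hp.continuous_potMinus hV hz) z.1) hU.2 hs.2 (hU.1.trans hs.1.symm)]

theorem IsStandingWaveFamily.exists_fundamental (h : IsStandingWaveFamily V φ ω δ)
    (hV : Continuous V) {z : ℂ × ℝ} (hz : |z.2| < δ) :
    ∃ U, IsFundamental (coupledSystem (potPlus V φ ω z.2) (potMinus V φ ω z.2) z.1) U :=
  exists_isFundamental (continuous_coupledSystem (h.continuous_potPlus hV hz)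
    (h.continuous_potMinus hV hz) z.1)

theorem IsStandingWaveFamily.complexMonodromy_symplectic (h : IsStandingWaveFamily V φ ω δ)
    (hV : Continuous V) {z : ℂ × ℝ} (hz : |z.2| < δ) :
    (complexMonodromy V φ ω z)ᵀ * symplecticForm * complexMonodromy V φ ω z = symplecticForm := by
  obtain ⟨U, hU⟩ := h.exists_fundamental hV hz
  rw [← hU.eq_complexMonodromy h hV hz]
  exact hU.preserves_form (coupledSystem_hamiltonian _ _ _) 1

theorem IsStandingWaveFamily.complexMonodromy_ofReal (h : IsStandingWaveFamily V φ ω δ)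
    (hV : Continuous V) {ε : ℝ} (hε : |ε| < δ) (μ : ℝ) :
    complexMonodromy V φ ω (μ, ε) = (stabilityMonodromy V φ ω μ ε).map Complex.ofReal := by
  obtain ⟨U, hU⟩ := h.exists_fundamental hV (z := ((μ : ℂ), ε)) hε
  rw [← hU.eq_complexMonodromy h hV hε]
  have hU' : IsFundamental (fun x => (stabilitySystem V φ ω μ ε x).map Complex.ofReal) U := by
    simpa only [map_stabilitySystem] using hU
  refine hU'.eq_map_monodromy fun i j => ?_
  have h1 := h.continuous_potPlus hV hε
  have h2 := h.continuous_potMinus hV hε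
  fin_cases i <;> fin_cases j <;> simp [stabilitySystem] <;> fun_prop

theorem IsStandingWaveFamily.trace_ofReal (h : IsStandingWaveFamily V φ ω δ)
    (hV : Continuous V) {ε : ℝ} (hε : |ε| < δ) (μ : ℝ) :
    (complexMonodromy V φ ω (μ, ε)).trace = ((stabilityMonodromy V φ ω μ ε).trace : ℝ) := by
  rw [h.complexMonodromy_ofReal hV hε]
  simp [Matrix.trace]

theorem IsStandingWaveFamily.radicand_eq (h : IsStandingWaveFamily V φ ω δ)
    (hV : Continuous V) {ε : ℝ} (hε : |ε| < δ) (μ : ℝ) :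
    (radicand V φ ω μ ε : ℂ) = (splitting (complexMonodromy V φ ω (μ, ε)) *
      splitting (complexMonodromy V φ ω (μ, ε))).trace := by
  rw [trace_splitting_sq (h.complexMonodromy_symplectic hV hε), h.complexMonodromy_ofReal hV hε,
    radicand]
  have : (stabilityMonodromy V φ ω μ ε).map Complex.ofReal ^ 2 =
      (stabilityMonodromy V φ ω μ ε ^ 2).map Complex.ofReal := by
    rw [sq, sq]
    ext i j
    simp [Matrix.mul_apply]
  rw [this]
  simp [Matrix.trace]

/-- The monodromy matrix is a `C¹` function of `(μ, ε)`: it is the value at `1` of the propagator,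
which depends smoothly on the coefficient, and the coefficient is a `C¹` curve of continuous
functions. -/
theorem IsStandingWaveFamily.contDiffAt_complexMonodromy (h : IsStandingWaveFamily V φ ω δ)
    (hV : Continuous V) (μ₀ : ℂ) : ContDiffAt ℝ 1 (complexMonodromy V φ ω) (μ₀, 0) := by
  have hδ := h.delta_pos
  have hle : -(δ / 2) ≤ δ / 2 := by linarith
  have hclamp : ∀ ε, (projIcc (-(δ / 2)) (δ / 2) hle ε : ℝ) ∈ Ioo (-δ) δ := fun ε =>
    ⟨by linarith [(projIcc (-(δ / 2)) (δ / 2) hle ε).2.1],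
      by linarith [(projIcc (-(δ / 2)) (δ / 2) hle ε).2.2]⟩
  -- the profiles as a curve in `C([-1, 1])`, with `ε` clamped so that they are continuous
  set Φ : ℝ → C(Icc (-1 : ℝ) 1, ℝ) := fun ε =>
    ⟨fun t => φ t (projIcc (-(δ / 2)) (δ / 2) hle ε),
      (h.continuous_profile (abs_lt.2 (hclamp ε))).comp continuous_subtype_val⟩ with hΦdef
  have hΦ : ∀ ε, |ε| < δ / 2 → ∀ t, Φ ε t = φ t ε := by
    intro ε hε t
    have : projIcc (-(δ / 2)) (δ / 2) hle ε = (⟨ε, (abs_le.1 hε.le)⟩ : Icc (-(δ / 2)) (δ / 2)) :=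
      projIcc_of_mem hle (abs_le.1 hε.le)
    simp [hΦdef, this]
  have hΦc : ContDiffAt ℝ 1 Φ 0 := contDiffAt_curve (h.contDiff_profile.of_le (by norm_num))
    (half_pos hδ) (by linarith) hΦ
  have hωc : ContDiffAt ℝ 1 ω 0 := (h.contDiff_frequency.of_le (by norm_num)).contDiffAt
    (Ioo_mem_nhds (by linarith) hδ)
  set Ep : Matrix (Fin 4) (Fin 4) ℂ := !![0, 0, 0, 0; 2, 0, 0, 0; 0, 0, 0, 0; 0, 0, 0, 0]
  set Em : Matrix (Fin 4) (Fin 4) ℂ := !![0, 0, 0, 0; 0, 0, 0, 0; 0, 0, 0, 0; 0, 0, 2, 0]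
  set B : Matrix (Fin 4) (Fin 4) ℂ := !![0, 0, 0, 0; 0, 0, -2, 0; 0, 0, 0, 0; -2, 0, 0, 0]
  set A₀ : C(Icc (-1 : ℝ) 1, Matrix (Fin 4) (Fin 4) ℂ) :=
    ⟨fun t => coupledSystem V V 0 t,
      (continuous_coupledSystem hV hV 0).comp continuous_subtype_val⟩
  -- `3 ε φ²`, which enters `L₊` as it stands and `L₋` with the factor `1 / 3`
  set f : ℝ → C(Icc (-1 : ℝ) 1, ℝ) := fun ε => (3 * ε) • (Φ ε * Φ ε)
  have hfc : ContDiffAt ℝ 1 f 0 := (contDiffAt_const.mul contDiffAt_id).smul (hΦc.mul hΦc)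
  have hval : ∀ z : ℂ × ℝ, |z.2| < δ / 2 → ∀ t,
      coeffFamily A₀ B (Ep + (1 / 3 : ℂ) • Em) (Ep + Em) f ω z t =
        coupledSystem (potPlus V φ ω z.2) (potMinus V φ ω z.2) z.1 t := by
    intro z hz t
    have e : f z.2 t = 3 * z.2 * (φ t z.2 * φ t z.2) := by
      rw [← hΦ _ hz]; rfl
    refine (coeffFamily_apply A₀ _ _ _ _ _ z t).trans ?_
    rw [e]
    change coupledSystem V V 0 t + z.1 • B + _ - _ = _
    ext i j
    fin_cases i <;> fin_cases j <;>
      simp [coupledSystem, potPlus, potMinus, Ep, Em, B] <;> ring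
  have h1 : (1 : ℝ) ∈ Icc (-1 : ℝ) 1 := by norm_num
  have hprop := contDiffAt_propagator_coeffFamily A₀ B (Ep + (1 / 3 : ℂ) • Em) (Ep + Em) hfc hωc μ₀
    ⟨1, h1⟩
  refine hprop.congr_of_eventuallyEq ?_
  have hnhds : ∀ᶠ z : ℂ × ℝ in 𝓝 (μ₀, 0), |z.2| < δ / 2 :=
    (continuous_abs.comp continuous_snd).continuousAt.eventually
      (gt_mem_nhds (by simpa using hδ))
  filter_upwards [hnhds] with z hz
  have hzδ : |z.2| < δ := by linarith
  obtain ⟨U, hU⟩ := h.exists_fundamental hV hzδ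
  rw [← hU.eq_complexMonodromy h hV hzδ]
  exact hU.eq_propagator (continuous_coupledSystem (h.continuous_potPlus hV hzδ)
    (h.continuous_potMinus hV hzδ) z.1) (hval z hz) ⟨1, h1⟩

end Family

/-! ### Persistence of a nonreal root -/

section Persistence

open Matrix Metric

/-- A real quadratic polynomial with negative discriminant has a simple nonreal root. -/
theorem exists_nonreal_simple_root {a b c : ℝ} (h : b ^ 2 - 4 * a * c < 0) :
    ∃ m : ℂ, m.im ≠ 0 ∧ a * m ^ 2 + b * m + c = 0 ∧ 2 * a * m + b ≠ 0 := by
  have ha : a ≠ 0 := by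
    rintro rfl
    nlinarith [sq_nonneg b]
  set d := Real.sqrt (4 * a * c - b ^ 2)
  have hdpos : 0 < d := Real.sqrt_pos.2 (by linarith)
  have hd2 : d ^ 2 = 4 * a * c - b ^ 2 := Real.sq_sqrt (by linarith)
  have ha' : (a : ℂ) ≠ 0 := by exact_mod_cast ha
  refine ⟨⟨-b / (2 * a), d / (2 * a)⟩, ?_, ?_, ?_⟩
  · exact div_ne_zero hdpos.ne' (mul_ne_zero two_ne_zero ha)
  · apply Complex.ext
    · simp [sq]
      field_simp
      linear_combination -hd2
    · simp [sq]
      field_simp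
      ring
  · intro h0
    have := congrArg Complex.im h0
    simp at this
    field_simp at this
    rcases this with h | h | h
    · exact ha h
    · exact hdpos.ne' h
    · exact ha h

variable {S : ℂ × ℝ → ℂ} {Z : ℂ × ℝ → Matrix (Fin 4) (Fin 4) ℂ} {p₀ K₀ : ℝ}
  {S' : ℂ × ℝ →L[ℝ] ℂ} {Z' : ℂ × ℝ →L[ℝ] Matrix (Fin 4) (Fin 4) ℂ}
  {Zμ Zε : Matrix (Fin 4) (Fin 4) ℂ} {S₁ σ s₂ β γ₀ κ : ℝ}

/-- The derivative of `(k, t, z) ↦ (k - t)² - Tr z²`. -/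
theorem exists_hasStrictFDerivAt_quadratic (w : ℝ × ℂ × Matrix (Fin 4) (Fin 4) ℂ) :
    ∃ Q' : ℝ × ℂ × Matrix (Fin 4) (Fin 4) ℂ →L[ℝ] ℂ × ℝ,
      HasStrictFDerivAt (fun w : ℝ × ℂ × Matrix (Fin 4) (Fin 4) ℂ =>
        (((w.1 : ℂ) - w.2.1) * ((w.1 : ℂ) - w.2.1) - (w.2.2 * w.2.2).trace, w.1)) Q' w ∧
      ∀ v, Q' v = (2 * ((w.1 : ℂ) - w.2.1) * ((v.1 : ℂ) - v.2.1) - 2 * (w.2.2 * v.2.2).trace,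
        v.1) := by
  set π₁ : ℝ × ℂ × Matrix (Fin 4) (Fin 4) ℂ →L[ℝ] ℂ :=
    Complex.ofRealCLM.comp (ContinuousLinearMap.fst ℝ ℝ (ℂ × Matrix (Fin 4) (Fin 4) ℂ)) -
      (ContinuousLinearMap.fst ℝ ℂ (Matrix (Fin 4) (Fin 4) ℂ)).comp
        (ContinuousLinearMap.snd ℝ ℝ (ℂ × Matrix (Fin 4) (Fin 4) ℂ))
  set π₂ : ℝ × ℂ × Matrix (Fin 4) (Fin 4) ℂ →L[ℝ] Matrix (Fin 4) (Fin 4) ℂ :=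
    (ContinuousLinearMap.snd ℝ ℂ (Matrix (Fin 4) (Fin 4) ℂ)).comp
      (ContinuousLinearMap.snd ℝ ℝ (ℂ × Matrix (Fin 4) (Fin 4) ℂ))
  have h1 := (π₁.hasStrictFDerivAt (x := w)).mul (π₁.hasStrictFDerivAt (x := w))
  have h2 := (π₂.hasStrictFDerivAt (x := w)).mul' (π₂.hasStrictFDerivAt (x := w))
  have h3 := ((traceCLM (n := 4)).restrictScalars ℝ).hasStrictFDerivAt.comp w h2
  have h4 := (h1.sub h3).prodMk
    ((ContinuousLinearMap.fst ℝ ℝ (ℂ × Matrix (Fin 4) (Fin 4) ℂ)).hasStrictFDerivAt (x := w))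
  refine ⟨_, h4, fun v => ?_⟩
  have e1 : ∀ v, π₁ v = (v.1 : ℂ) - v.2.1 := fun v => rfl
  have e2 : ∀ v, π₂ v = v.2.2 := fun v => rfl
  ext1
  · change π₁ w * π₁ v + π₁ w * π₁ v - (π₂ w * π₂ v + π₂ v * π₂ w).trace = _
    rw [trace_add, Matrix.trace_mul_comm (π₂ v), e1, e1, e2, e2]
    ring
  · rfl

/-- Let `Z` vanish at `(p₀, 0)`. The equation `(2 K - S)² = Tr Z²`, with `μ = p₀ + ε m` and
`K = K₀ + ε k / 2`, becomes in the limit `ε → 0` a quadratic equation for `m` with real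
coefficients. When this has a negative discriminant, its nonreal root `m` persists for small `ε` and
depends continuously on `k`. -/
theorem exists_nonreal_arc
    (hS : HasStrictFDerivAt S S' ((p₀ : ℂ), 0)) (hZ : HasStrictFDerivAt Z Z' ((p₀ : ℂ), 0))
    (hS0 : S ((p₀ : ℂ), 0) = 2 * K₀) (hZ0 : Z ((p₀ : ℂ), 0) = 0)
    (hS' : ∀ m e, S' (m, e) = S₁ * m + σ * e)
    (hZ' : ∀ m e, Z' (m, e) = m • Zμ + (e : ℂ) • Zε)
    (hs₂ : (Zμ * Zμ).trace = s₂) (hβ : 2 * (Zε * Zμ).trace = β) (hγ₀ : (Zε * Zε).trace = γ₀)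
    (hdisc : (2 * S₁ * κ + β) ^ 2 - 4 * (S₁ ^ 2 - s₂) * (κ ^ 2 - γ₀) < 0)
    {r ρ : ℝ} (hr : 0 < r) (hρ : 0 < ρ) :
    ∃ ε₀ > 0, ∀ ε : ℝ, 0 < |ε| → |ε| < ε₀ → ∃ (a b : ℝ) (c : ℝ → ℂ), a < b ∧
      ContinuousOn c (Icc a b) ∧ ∀ K ∈ Icc a b, |K - K₀| < ρ ∧ (c K).im ≠ 0 ∧ ‖c K - p₀‖ < r ∧
        (2 * (K : ℂ) - S (c K, ε)) ^ 2 = (Z (c K, ε) * Z (c K, ε)).trace := by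
  obtain ⟨m₀, hm₀, hroot, hsimple⟩ := exists_nonreal_simple_root
    (a := S₁ ^ 2 - s₂) (b := -(2 * S₁ * κ + β)) (c := κ ^ 2 - γ₀) (by linarith)
  push_cast at hroot hsimple
  set k₀ := κ + σ with hk₀
  set u₀ : ℂ × ℝ := (m₀, k₀ / 2) with hu₀
  -- the map to blow up, with the shifted discriminant `K` as an extra variable
  set X : (ℂ × ℝ) × ℝ → ℝ × ℂ × Matrix (Fin 4) (Fin 4) ℂ := fun w =>
    (2 * (w.1.2 - K₀), S (w.1.1, w.2) - 2 * K₀, Z (w.1.1, w.2)) with hX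
  set prj : (ℂ × ℝ) × ℝ →L[ℝ] ℂ × ℝ :=
    ((ContinuousLinearMap.fst ℝ ℂ ℝ).comp (ContinuousLinearMap.fst ℝ (ℂ × ℝ) ℝ)).prod
      (ContinuousLinearMap.snd ℝ (ℂ × ℝ) ℝ)
  set prK : (ℂ × ℝ) × ℝ →L[ℝ] ℝ :=
    (ContinuousLinearMap.snd ℝ ℂ ℝ).comp (ContinuousLinearMap.fst ℝ (ℂ × ℝ) ℝ)
  have hXd : HasStrictFDerivAt X (((2 : ℝ) • prK).prod ((S'.comp prj).prod (Z'.comp prj)))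
      (((p₀ : ℂ), K₀), 0) := by
    have e1 : HasStrictFDerivAt (fun w : (ℂ × ℝ) × ℝ => 2 * (w.1.2 - K₀)) ((2 : ℝ) • prK)
        (((p₀ : ℂ), K₀), 0) := (prK.hasStrictFDerivAt.sub_const K₀).const_mul 2
    have e2 : HasStrictFDerivAt (fun w : (ℂ × ℝ) × ℝ => S (w.1.1, w.2) - 2 * K₀) (S'.comp prj)
        (((p₀ : ℂ), K₀), 0) :=
      (HasStrictFDerivAt.comp (f := prj) (((p₀ : ℂ), K₀), 0) hS prj.hasStrictFDerivAt).sub_const _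
    have e3 : HasStrictFDerivAt (fun w : (ℂ × ℝ) × ℝ => Z (w.1.1, w.2)) (Z'.comp prj)
        (((p₀ : ℂ), K₀), 0) :=
      HasStrictFDerivAt.comp (f := prj) (((p₀ : ℂ), K₀), 0) hZ prj.hasStrictFDerivAt
    exact e1.prodMk (e2.prodMk e3)
  set X' := ((2 : ℝ) • prK).prod ((S'.comp prj).prod (Z'.comp prj)) with hX'
  have hX'v : ∀ m k e, X' ((m, k), e) = (2 * k, S₁ * m + σ * e, m • Zμ + (e : ℂ) • Zε) := by
    intro m k e
    rw [← hS', ← hZ']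
    rfl
  have hX0 : X (((p₀ : ℂ), K₀), 0) = 0 := by
    simp only [hX, hS0, hZ0]
    simp
  obtain ⟨Q', hQ, hQ'⟩ := exists_hasStrictFDerivAt_quadratic (X' (u₀, 1))
  set Q : ℝ × ℂ × Matrix (Fin 4) (Fin 4) ℂ → ℂ × ℝ := fun w =>
        (((w.1 : ℂ) - w.2.1) * ((w.1 : ℂ) - w.2.1) - (w.2.2 * w.2.2).trace, w.1) with hQdef
  have hβ' : (Zε * Zμ).trace = β / 2 := by rw [← hβ]; ring
  have hβ'' : (Zμ * Zε).trace = β / 2 := by rw [Matrix.trace_mul_comm, hβ']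
  have hx0 : X' (u₀, 1) = (k₀, S₁ * m₀ + σ, m₀ • Zμ + Zε) := by
    rw [hu₀, hX'v]
    simp
    ring
  have hQ0 : Q (X' (u₀, 1)) = (0, k₀) := by
    rw [hx0]
    simp only [hQdef, add_mul, mul_add, smul_mul_assoc, mul_smul_comm, trace_add, trace_smul, hs₂,
      hβ', hβ'', hγ₀, smul_eq_mul, hk₀]
    refine Prod.ext ?_ rfl
    push_cast
    linear_combination hroot
  set lin : ℂ × ℝ →ₗ[ℝ] ℂ × ℝ :=
    ((Q'.comp X').comp (ContinuousLinearMap.inl ℝ (ℂ × ℝ) ℝ)).toLinearMap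
  have hlinv : ∀ u, lin u = Q' (X' (u, 0)) := fun u => rfl
  have hinj : Function.Injective lin := by
    rw [injective_iff_map_eq_zero]
    rintro ⟨m, k⟩ h0
    rw [hlinv, hX'v, hQ', hx0] at h0
    have hk : k = 0 := by simpa using congrArg Prod.snd h0
    have h1 := congrArg Prod.fst h0
    simp only [hk, add_mul, smul_mul_assoc, mul_smul_comm, trace_add, trace_smul, hs₂, mul_add,
      hβ', smul_eq_mul, Prod.fst_zero, Complex.ofReal_zero, zero_smul, mul_zero,
      add_zero, hk₀] at h1
    have h2 : (2 * ((S₁ : ℂ) ^ 2 - s₂) * m₀ + -(2 * S₁ * κ + β)) * m = 0 := by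
      push_cast at h1
      linear_combination h1
    rw [(mul_eq_zero.1 h2).resolve_left hsimple, hk]
    rfl
  set L : (ℂ × ℝ) ≃L[ℝ] (ℂ × ℝ) := (LinearEquiv.ofInjectiveEndo lin hinj).toContinuousLinearEquiv
  have hL : ∀ u, L u = Q' (X' (u, 0)) := fun u => rfl
  obtain ⟨η, hη, ε₁, hε₁, hmain⟩ := exists_scaled_inverse hXd hX0 hQ L hL
    (abs_pos.2 hm₀)
  change ∀ ε : ℝ, 0 < |ε| → |ε| < ε₁ → ∃ g : ℂ × ℝ → ℂ × ℝ,
      ContinuousOn g (closedBall (Q (X' (u₀, 1))) η) ∧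
      ∀ v ∈ closedBall (Q (X' (u₀, 1))) η, g v ∈ ball u₀ |m₀.im| ∧
        Q (ε⁻¹ • X (((p₀ : ℂ), K₀) + ε • g v, ε)) = v at hmain
  rw [hQ0] at hmain
  have hC : 0 < ‖m₀‖ + |m₀.im| := by positivity
  have hC2 : 0 < |k₀| / 2 + η / 2 := by positivity
  refine ⟨min ε₁ (min (r / (‖m₀‖ + |m₀.im|)) (ρ / (|k₀| / 2 + η / 2))), by positivity,
    fun ε hε0 hε => ?_⟩
  rw [lt_min_iff, lt_min_iff, lt_div_iff₀ hC, lt_div_iff₀ hC2] at hε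
  obtain ⟨hε1, hεr, hερ⟩ := hε
  have hεne : ε ≠ 0 := abs_pos.1 hε0
  have hεc : (ε : ℂ) ≠ 0 := by exact_mod_cast hεne
  obtain ⟨g, hgc, hg⟩ := hmain ε hε0 hε1
  set v : ℝ → ℂ × ℝ := fun K => (0, 2 * (K - K₀) / ε) with hv
  have hvK : ∀ K, |K - (K₀ + ε * k₀ / 2)| ≤ |ε| * η / 2 → v K ∈ closedBall ((0 : ℂ), k₀) η := by
    intro K hK
    have e : 2 * (K - K₀) / ε - k₀ = 2 * (K - (K₀ + ε * k₀ / 2)) / ε := by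
      field_simp
      ring
    rw [mem_closedBall, Prod.dist_eq, max_le_iff, Real.dist_eq, e, dist_self, abs_div, abs_mul,
      div_le_iff₀ hε0, abs_two]
    exact ⟨hη.le, by linarith⟩
  have hpos : 0 < |ε| * η / 2 := by positivity
  have hIcc : ∀ K ∈ Icc (K₀ + ε * k₀ / 2 - |ε| * η / 2) (K₀ + ε * k₀ / 2 + |ε| * η / 2),
      |K - (K₀ + ε * k₀ / 2)| ≤ |ε| * η / 2 := fun K hK =>
    abs_le.2 ⟨by linarith [hK.1], by linarith [hK.2]⟩
  refine ⟨K₀ + ε * k₀ / 2 - |ε| * η / 2, K₀ + ε * k₀ / 2 + |ε| * η / 2,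
    fun K => p₀ + ε * (g (v K)).1, by linarith, ?_, fun K hK => ?_⟩
  · have h1 : ContinuousOn (fun K => g (v K))
        (Icc (K₀ + ε * k₀ / 2 - |ε| * η / 2) (K₀ + ε * k₀ / 2 + |ε| * η / 2)) :=
      hgc.comp (by fun_prop) fun K hK => hvK K (hIcc K hK)
    exact continuousOn_const.add (continuousOn_const.mul (continuous_fst.comp_continuousOn h1))
  · obtain ⟨hball, hQv⟩ := hg _ (hvK K (hIcc K hK))
    rcases hgv : g (v K) with ⟨m, k⟩
    rw [hgv] at hball hQv
    have hm : ‖m - m₀‖ < |m₀.im| := by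
      have := (max_lt_iff.1 (mem_ball.1 hball)).1
      rwa [dist_eq_norm] at this
    simp only [hgv]
    refine ⟨?_, ?_, ?_, ?_⟩
    · have h1 := hIcc K hK
      have h2 : |K - K₀| ≤ |K - (K₀ + ε * k₀ / 2)| + |ε * k₀ / 2| := by
        have := abs_add_le (K - (K₀ + ε * k₀ / 2)) (ε * k₀ / 2)
        rwa [show K - (K₀ + ε * k₀ / 2) + ε * k₀ / 2 = K - K₀ by ring] at this
      have h3 : |ε * k₀ / 2| = |ε| * (|k₀| / 2) := by
        rw [abs_div, abs_mul, abs_two, mul_div_assoc]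
      rw [h3] at h2
      linarith
    · have h1 : |(m - m₀).im| < |m₀.im| := (Complex.abs_im_le_norm _).trans_lt hm
      have h2 : m.im ≠ 0 := by
        intro h0
        rw [Complex.sub_im, h0, zero_sub, abs_neg] at h1
        exact lt_irrefl _ h1
      simpa using ⟨hεne, h2⟩
    · have h1 : ‖m‖ < ‖m₀‖ + |m₀.im| := by
        have := norm_add_le m₀ (m - m₀)
        rw [add_sub_cancel] at this
        linarith
      rw [add_sub_cancel_left, norm_mul, Complex.norm_real, Real.norm_eq_abs]
      exact (mul_lt_mul_of_pos_left h1 hε0).trans hεr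
    · have hk := congrArg Prod.snd hQv
      have h1 := congrArg Prod.fst hQv
      simp only [hQdef, hX, hv, Prod.smul_fst, Prod.smul_snd, Prod.fst_add, Prod.snd_add,
        smul_eq_mul, add_sub_cancel_left, Complex.real_smul] at hk h1
      have hkK : K₀ + ε * k = K := by
        field_simp at hk
        linarith
      have h3 : ((ε⁻¹ * (2 * (ε * k)) : ℝ) : ℂ) = (ε : ℂ)⁻¹ * (2 * (K - K₀)) := by
        rw [← hkK]; push_cast; ring
      have h4 : (ε⁻¹ • Z ((p₀ : ℂ) + ε * m, ε)) * (ε⁻¹ • Z ((p₀ : ℂ) + ε * m, ε)) =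
          ((ε : ℂ)⁻¹ ^ 2) • (Z ((p₀ : ℂ) + ε * m, ε) * Z ((p₀ : ℂ) + ε * m, ε)) := by
        have : ∀ M : Matrix (Fin 4) (Fin 4) ℂ, ε⁻¹ • M = (ε : ℂ)⁻¹ • M := fun M => by
          rw [← Complex.ofReal_inv]; rfl
        rw [this, smul_mul_smul_comm, sq]
      rw [h4, h3, trace_smul, smul_eq_mul, Complex.ofReal_inv] at h1
      field_simp at h1
      linear_combination h1

end Persistence

/-! ### Taylor coefficients of the radicand -/

section Coefficients

open Matrix

/-- The product rule at a zero of `f` needs only continuity of `g`. -/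
theorem hasDerivAt_mul_of_eq_zero {R : Type*} [NormedRing R] [NormedAlgebra ℂ R]
    {f g : ℝ → R} {f' : R} {t : ℝ}
    (hf : HasDerivAt f f' t) (h0 : f t = 0) (hg : ContinuousAt g t) :
    HasDerivAt (fun s => f s * g s) (f' * g t) t := by
  rw [hasDerivAt_iff_tendsto_slope] at hf ⊢
  refine (hf.mul (hg.tendsto.mono_left nhdsWithin_le_nhds)).congr fun s => ?_
  simp [slope_def_module, h0]

/-- The derivative of a real function differentiated as a complex-valued one. -/
theorem deriv_eq_of_hasDerivAt_ofReal {g : ℝ → ℝ} {c : ℂ} {t : ℝ}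
    (h : HasDerivAt (fun s => (g s : ℂ)) c t) : c = (deriv g t : ℝ) := by
  have hre : HasDerivAt g c.re t := by
    exact Complex.reCLM.hasFDerivAt.comp_hasDerivAt t h
  rw [hre.deriv]
  exact h.unique hre.ofReal_comp

variable {Z : ℂ × ℝ → Matrix (Fin 4) (Fin 4) ℂ} {l : ℝ → ℂ × ℝ} {d d₀ : ℂ × ℝ} {t : ℝ}

theorem hasDerivAt_trace_mul_self (hZ : DifferentiableAt ℝ Z (l t)) (hl : HasDerivAt l d t) :
    HasDerivAt (fun s => (Z (l s) * Z (l s)).trace)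
      (2 * (Z (l t) * fderiv ℝ Z (l t) d).trace) t := by
  have h := hZ.hasFDerivAt.comp_hasDerivAt t hl
  have h2 := ((traceCLM (n := 4)).restrictScalars ℝ).hasFDerivAt.comp_hasDerivAt t (h.mul h)
  refine h2.congr_deriv ?_
  change (fderiv ℝ Z (l t) d * Z (l t) + Z (l t) * fderiv ℝ Z (l t) d).trace = _
  rw [trace_add, Matrix.trace_mul_comm (fderiv ℝ Z (l t) d)]
  ring

/-- Where `Z` vanishes, the second derivatives of `Tr Z²` involve only the first derivatives
of `Z`. -/
theorem hasDerivAt_trace_mul_fderiv (hZ : ContDiffAt ℝ 1 Z (l t)) (hl : HasDerivAt l d₀ t)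
    (h0 : Z (l t) = 0) :
    HasDerivAt (fun s => 2 * (Z (l s) * fderiv ℝ Z (l s) d).trace)
      (2 * (fderiv ℝ Z (l t) d₀ * fderiv ℝ Z (l t) d).trace) t := by
  have h := (hZ.differentiableAt (by norm_num)).hasFDerivAt.comp_hasDerivAt t hl
  have hc : ContinuousAt (fun s => fderiv ℝ Z (l s) d) t :=
    ((hZ.fderiv_right (m := 0) (by norm_num)).continuousAt.comp hl.continuousAt).clm_apply
      continuousAt_const
  have h2 := hasDerivAt_mul_of_eq_zero h h0 hc
  exact (((traceCLM (n := 4)).restrictScalars ℝ).hasFDerivAt.comp_hasDerivAt t h2).const_mul 2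

theorem eventually_differentiableAt (hZ : ContDiffAt ℝ 1 Z (l t)) (hl : ContinuousAt l t) :
    ∀ᶠ s in 𝓝 t, DifferentiableAt ℝ Z (l s) := by
  have h : ∀ᶠ z in 𝓝 (l t), ContDiffAt ℝ 1 Z z := hZ.eventually (by norm_num)
  exact (hl.eventually h).mono fun s hs => hs.differentiableAt (by norm_num)

variable {V : ℝ → ℝ} {φ : ℝ → ℝ → ℝ} {ω : ℝ → ℝ} {δ : ℝ}

theorem IsStandingWaveFamily.eventually_abs_lt (h : IsStandingWaveFamily V φ ω δ) :
    ∀ᶠ ε : ℝ in 𝓝 0, |ε| < δ :=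
  continuous_abs.continuousAt.eventually (gt_mem_nhds (by simpa using h.delta_pos))

/-- The trace-free part of `M + M⁻¹` along the family; the radicand is the trace of its square. -/
noncomputable def familySplitting (V : ℝ → ℝ) (φ : ℝ → ℝ → ℝ) (ω : ℝ → ℝ) (z : ℂ × ℝ) :
    Matrix (Fin 4) (Fin 4) ℂ :=
  splitting (complexMonodromy V φ ω z)

theorem IsStandingWaveFamily.contDiffAt_familySplitting (h : IsStandingWaveFamily V φ ω δ)
    (hV : Continuous V) (μ : ℂ) : ContDiffAt ℝ 1 (familySplitting V φ ω) (μ, 0) :=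
  ((LinearMap.toContinuousLinearMap splitting).restrictScalars ℝ).contDiff.contDiffAt.comp _
    (h.contDiffAt_complexMonodromy hV μ)

/-- `β` in terms of the first derivatives of `Z` at its zero `(μ*, 0)`. -/
theorem IsStandingWaveFamily.mixedCoeff_eq (h : IsStandingWaveFamily V φ ω δ)
    (hV : Continuous V) {μs : ℝ} (h0 : familySplitting V φ ω (μs, 0) = 0) :
    2 * (fderiv ℝ (familySplitting V φ ω) (μs, 0) (0, 1) *
      fderiv ℝ (familySplitting V φ ω) (μs, 0) (1, 0)).trace = (mixedCoeff V φ ω μs : ℝ) := by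
  set Z := familySplitting V φ ω
  have hZc : ContDiffAt ℝ 1 Z ((μs : ℂ), 0) := h.contDiffAt_familySplitting hV μs
  have hl : HasDerivAt (fun ε : ℝ => ((μs : ℂ), ε)) ((0 : ℂ), (1 : ℝ)) 0 :=
    (hasDerivAt_const _ _).prodMk (hasDerivAt_id _)
  refine deriv_eq_of_hasDerivAt_ofReal (HasDerivAt.congr_of_eventuallyEq
    (hasDerivAt_trace_mul_fderiv (d := ((1 : ℂ), (0 : ℝ))) (l := fun ε : ℝ => ((μs : ℂ), ε))
      (t := 0) hZc hl h0) ?_)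
  filter_upwards [h.eventually_abs_lt, eventually_differentiableAt (l := fun ε : ℝ => ((μs : ℂ), ε))
    (t := 0) hZc hl.continuousAt] with ε hε hdiff
  have hl2 : HasDerivAt (fun μ : ℝ => ((μ : ℂ), ε)) ((1 : ℂ), (0 : ℝ)) μs :=
    Complex.ofRealCLM.hasDerivAt.prodMk (hasDerivAt_const _ _)
  have h1 := hasDerivAt_trace_mul_self (l := fun μ : ℝ => ((μ : ℂ), ε)) (t := μs) hdiff hl2
  refine (deriv_eq_of_hasDerivAt_ofReal (h1.congr_of_eventuallyEq
    (Eventually.of_forall fun μ => ?_))).symm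
  exact h.radicand_eq hV hε μ

/-- `γ₀` in terms of the `ε`-derivative of `Z` at its zero `(μ*, 0)`. -/
theorem IsStandingWaveFamily.epsSqCoeff_eq (h : IsStandingWaveFamily V φ ω δ)
    (hV : Continuous V) {μs : ℝ} (h0 : familySplitting V φ ω (μs, 0) = 0) :
    (fderiv ℝ (familySplitting V φ ω) (μs, 0) (0, 1) *
      fderiv ℝ (familySplitting V φ ω) (μs, 0) (0, 1)).trace = (epsSqCoeff V φ ω μs : ℝ) := by
  set Z := familySplitting V φ ω
  have hZc : ContDiffAt ℝ 1 Z ((μs : ℂ), 0) := h.contDiffAt_familySplitting hV μs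
  have hl : ∀ t, HasDerivAt (fun ε : ℝ => ((μs : ℂ), ε)) ((0 : ℂ), (1 : ℝ)) t := fun t =>
    (hasDerivAt_const _ _).prodMk (hasDerivAt_id _)
  have key : 2 * (fderiv ℝ Z (μs, 0) (0, 1) * fderiv ℝ Z (μs, 0) (0, 1)).trace =
      (deriv (deriv fun ε => radicand V φ ω μs ε) 0 : ℝ) := by
    refine deriv_eq_of_hasDerivAt_ofReal (HasDerivAt.congr_of_eventuallyEq
      (hasDerivAt_trace_mul_fderiv (d := ((0 : ℂ), (1 : ℝ))) (l := fun ε : ℝ => ((μs : ℂ), ε))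
        (t := 0) hZc (hl 0) h0) ?_)
    filter_upwards [h.eventually_abs_lt.eventually_nhds, eventually_differentiableAt
      (l := fun ε : ℝ => ((μs : ℂ), ε)) (t := 0) hZc (hl 0).continuousAt] with ε hε hdiff
    have h1 := hasDerivAt_trace_mul_self (l := fun ε : ℝ => ((μs : ℂ), ε)) (t := ε) hdiff (hl ε)
    exact (deriv_eq_of_hasDerivAt_ofReal (h1.congr_of_eventuallyEq
      (hε.mono fun e he => h.radicand_eq hV he μs))).symm
  rw [epsSqCoeff, Complex.ofReal_div, ← key]
  push_cast
  ring

theorem IsStandingWaveFamily.exists_hasDerivAt_monodromy (h : IsStandingWaveFamily V φ ω δ)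
    (hV : Continuous V) {ε : ℝ} (hε : |ε| < δ) (μ : ℂ) :
    ∃ N, HasDerivAt (fun ν => complexMonodromy V φ ω (ν, ε)) N μ := by
  set B : Matrix (Fin 4) (Fin 4) ℂ := !![0, 0, 0, 0; 0, 0, -2, 0; 0, 0, 0, 0; -2, 0, 0, 0] with hB
  have hp := h.continuous_potPlus hV hε
  have hm := h.continuous_potMinus hV hε
  have heq : ∀ (ν : ℂ) (x : ℝ), coupledSystem (potPlus V φ ω ε) (potMinus V φ ω ε) ν x =
      coupledSystem (potPlus V φ ω ε) (potMinus V φ ω ε) 0 x + ν • B := by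
    intro ν x
    ext i j
    fin_cases i <;> fin_cases j <;> simp [coupledSystem, hB] <;> ring
  choose U hU using fun ν : ℂ => h.exists_fundamental hV (z := (ν, ε)) hε
  have hd := hasDerivAt_monodromy (continuous_coupledSystem hp hm 0) (B := B) (U := U)
    (fun ν => by simpa only [← heq] using hU ν) μ
    (a := ⟨fun t => coupledSystem (potPlus V φ ω ε) (potMinus V φ ω ε) μ t,
      (continuous_coupledSystem hp hm μ).comp continuous_subtype_val⟩)
    (b := ContinuousMap.const _ B) (fun t => heq μ t) (fun t => rfl)
  exact ⟨_, hd.congr_of_eventuallyEq (Eventually.of_forall fun ν =>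
    ((hU ν).eq_complexMonodromy h hV hε).symm)⟩

/-- The derivative of the monodromy matrix at `ε = 0` is complex linear in `μ`. -/
theorem IsStandingWaveFamily.fderiv_complexMonodromy_apply (h : IsStandingWaveFamily V φ ω δ)
    (hV : Continuous V) (μ m : ℂ) (e : ℝ) :
    fderiv ℝ (complexMonodromy V φ ω) (μ, 0) (m, e) =
      m • fderiv ℝ (complexMonodromy V φ ω) (μ, 0) (1, 0) +
        (e : ℂ) • fderiv ℝ (complexMonodromy V φ ω) (μ, 0) (0, 1) := by
  obtain ⟨N, hN⟩ := h.exists_hasDerivAt_monodromy hV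
    (ε := 0) (by simpa using h.delta_pos) μ
  have hd : HasFDerivAt (complexMonodromy V φ ω) _ (μ, (0 : ℝ)) :=
    ((h.contDiffAt_complexMonodromy hV μ).differentiableAt (by norm_num)).hasFDerivAt
  have hslice : ∀ m : ℂ, fderiv ℝ (complexMonodromy V φ ω) (μ, 0) (m, 0) = m • N := by
    intro m
    have h1 : HasFDerivAt (fun ν : ℂ => complexMonodromy V φ ω (ν, 0)) _ μ :=
      HasFDerivAt.comp (f := fun ν : ℂ => (ν, (0 : ℝ))) μ hd (hasFDerivAt_prodMk_left μ (0 : ℝ))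
    exact congrArg (fun L : ℂ →L[ℝ] Matrix (Fin 4) (Fin 4) ℂ => L m)
      (h1.unique (hN.hasFDerivAt.restrictScalars ℝ))
  have hsplit : (m, e) = (m, (0 : ℝ)) + e • ((0 : ℂ), (1 : ℝ)) := by simp
  rw [hsplit, map_add, map_smul, hslice m, hslice 1, one_smul]
  rfl

end Coefficients

/-! ### The bands that leave the real axis -/

section Bifurcation

open Matrix

/-- Existence of the shift `κ` of the discriminant for which the limiting quadratic equation has
nonreal roots; `k₁` and `k₂` stand for `k'(μ*)` and `k'(-μ*)`. -/
theorem exists_discriminant_neg {k₁ k₂ β γ₀ γ : ℝ} (hk₁ : k₁ ≠ 0)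
    (hγ : if k₁ + k₂ = 0 then γ = γ₀ else γ = γ₀ - β ^ 2 / (4 * (k₁ + k₂) ^ 2))
    (h : 0 < k₁ * k₂ * γ) :
    ∃ κ : ℝ, (2 * (k₁ - k₂) * κ + β) ^ 2 -
      4 * ((k₁ - k₂) ^ 2 - (k₁ + k₂) ^ 2) * (κ ^ 2 - γ₀) < 0 := by
  split_ifs at hγ with hs
  · obtain rfl : k₂ = -k₁ := by linarith
    subst hγ
    by_cases hβ : β = 0
    · refine ⟨0, ?_⟩
      subst hβ
      linarith
    · -- the left side is affine in `κ`, with slope `8 k₁ β`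
      refine ⟨-(β ^ 2 + 16 * k₁ ^ 2 * γ + 1) / (8 * k₁ * β), ?_⟩
      have e : (2 * (k₁ - -k₁) * (-(β ^ 2 + 16 * k₁ ^ 2 * γ + 1) / (8 * k₁ * β)) + β) ^ 2 -
          4 * ((k₁ - -k₁) ^ 2 - (k₁ + -k₁) ^ 2) *
            ((-(β ^ 2 + 16 * k₁ ^ 2 * γ + 1) / (8 * k₁ * β)) ^ 2 - γ) = -1 := by
        field_simp
        ring
      rw [e]
      norm_num
  · -- the left side is `4 (k₁ + k₂)² κ² + 4 (k₁ - k₂) β κ + const`; `κ` is its vertex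
    refine ⟨-((k₁ - k₂) * β) / (2 * (k₁ + k₂) ^ 2), ?_⟩
    have e : (2 * (k₁ - k₂) * (-((k₁ - k₂) * β) / (2 * (k₁ + k₂) ^ 2)) + β) ^ 2 -
      4 * ((k₁ - k₂) ^ 2 - (k₁ + k₂) ^ 2) *
        ((-((k₁ - k₂) * β) / (2 * (k₁ + k₂) ^ 2)) ^ 2 - γ₀) = -16 * (k₁ * k₂ * γ) := by
      rw [hγ]
      field_simp
      ring
    rw [e]
    linarith

/-- Both cases of the sign hypothesis amount to positivity of one product. -/
theorem mul_mul_pos_of_sign {a b c : ℝ} (ha : a ≠ 0) (hb : b ≠ 0)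
    (h : (SignType.sign a = SignType.sign b ∧ 0 < c) ∨
      (SignType.sign a = -SignType.sign b ∧ c < 0)) : 0 < a * b * c := by
  rcases lt_or_gt_of_ne ha with ha | ha <;> rcases lt_or_gt_of_ne hb with hb | hb <;>
    simp [sign_neg, sign_pos, ha, hb] at h
  · exact mul_pos (mul_pos_of_neg_of_neg ha hb) h
  · exact mul_pos_of_neg_of_neg (mul_neg_of_neg_of_pos ha hb) h
  · exact mul_pos_of_neg_of_neg (mul_neg_of_pos_of_neg ha hb) h
  · exact mul_pos (mul_pos ha hb) h

variable {V : ℝ → ℝ} {φ : ℝ → ℝ → ℝ} {ω : ℝ → ℝ} {δ : ℝ}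

/-- At `ε = 0` the stability problem decouples into two copies of Hill's equation. -/
theorem IsStandingWaveFamily.complexMonodromy_zero (h : IsStandingWaveFamily V φ ω δ)
    (hV : Continuous V) (ν : ℝ) :
    ∃ P Q, complexMonodromy V φ ω (ν, 0) = sumDiff P Q ∧
      P.trace = (hillDiscriminant V φ ω ν : ℝ) ∧ Q.trace = (hillDiscriminant V φ ω (-ν) : ℝ) := by
  have h0 : |(0 : ℝ)| < δ := by simpa using h.delta_pos
  have hm := h.continuous_potMinus hV h0
  have hpm : potPlus V φ ω 0 = potMinus V φ ω 0 := by
    funext x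
    simp [potPlus, potMinus]
  obtain ⟨P, hP⟩ := exists_isFundamental (continuous_complexHillSystem hm (ν : ℝ))
  obtain ⟨Q, hQ⟩ := exists_isFundamental (continuous_complexHillSystem hm ((-ν : ℝ) : ℂ))
  refine ⟨P 1, Q 1, ?_, hP.trace_hill hm, hQ.trace_hill hm⟩
  rw [Complex.ofReal_neg] at hQ
  have hU := isFundamental_sumDiff hP hQ
  refine (IsFundamental.eq_complexMonodromy h hV (z := ((ν : ℂ), 0)) h0
    (U := fun x => sumDiff (P x) (Q x)) ?_).symm
  simpa only [hpm] using hU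

theorem IsStandingWaveFamily.trace_complexMonodromy_zero (h : IsStandingWaveFamily V φ ω δ)
    (hV : Continuous V) (ν : ℝ) : (complexMonodromy V φ ω (ν, 0)).trace =
      ((hillDiscriminant V φ ω ν + hillDiscriminant V φ ω (-ν) : ℝ) : ℂ) := by
  obtain ⟨P, Q, h1, hP, hQ⟩ := h.complexMonodromy_zero hV ν
  rw [h1, trace_sumDiff, hP, hQ, Complex.ofReal_add]

theorem IsStandingWaveFamily.familySplitting_zero (h : IsStandingWaveFamily V φ ω δ)
    (hV : Continuous V) (ν : ℝ) : familySplitting V φ ω (ν, 0) =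
      (((hillDiscriminant V φ ω ν - hillDiscriminant V φ ω (-ν)) / 2 : ℝ) : ℂ) • exchange := by
  obtain ⟨P, Q, h1, hP, hQ⟩ := h.complexMonodromy_zero hV ν
  rw [familySplitting, h1, splitting_sumDiff, hP, hQ]
  push_cast
  rfl

theorem IsStandingWaveFamily.differentiable_hillDiscriminant (h : IsStandingWaveFamily V φ ω δ)
    (hV : Continuous V) : Differentiable ℝ (hillDiscriminant V φ ω) := fun ν =>
  (hill_discriminant_deriv (h.continuous_potMinus hV (by simpa using h.delta_pos)) ν).1

theorem IsStandingWaveFamily.deriv_hillDiscriminant_ne_zero (h : IsStandingWaveFamily V φ ω δ)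
    (hV : Continuous V) {ν : ℝ} (hν : hillDiscriminant V φ ω ν ∈ Ioo (-2 : ℝ) 2) :
    deriv (hillDiscriminant V φ ω) ν ≠ 0 :=
  (hill_discriminant_deriv (h.continuous_potMinus hV (by simpa using h.delta_pos)) ν).2 hν

theorem IsStandingWaveFamily.hasFDerivAt_complexMonodromy (h : IsStandingWaveFamily V φ ω δ)
    (hV : Continuous V) (μ : ℂ) : HasFDerivAt (complexMonodromy V φ ω)
      (fderiv ℝ (complexMonodromy V φ ω) (μ, 0)) (μ, 0) :=
  ((h.contDiffAt_complexMonodromy hV μ).differentiableAt (by norm_num)).hasFDerivAt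

theorem IsStandingWaveFamily.fderiv_familySplitting (h : IsStandingWaveFamily V φ ω δ)
    (hV : Continuous V) (μ : ℂ) (v : ℂ × ℝ) : fderiv ℝ (familySplitting V φ ω) (μ, 0) v =
      splitting (fderiv ℝ (complexMonodromy V φ ω) (μ, 0) v) := by
  have h1 := ((LinearMap.toContinuousLinearMap splitting).restrictScalars ℝ).hasFDerivAt.comp
    (μ, (0 : ℝ)) (h.hasFDerivAt_complexMonodromy hV μ)
  exact congrArg (fun L : ℂ × ℝ →L[ℝ] Matrix (Fin 4) (Fin 4) ℂ => L v) h1.fderiv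

theorem IsStandingWaveFamily.fderiv_familySplitting_apply (h : IsStandingWaveFamily V φ ω δ)
    (hV : Continuous V) (μ m : ℂ) (e : ℝ) :
    fderiv ℝ (familySplitting V φ ω) (μ, 0) (m, e) =
      m • fderiv ℝ (familySplitting V φ ω) (μ, 0) (1, 0) +
        (e : ℂ) • fderiv ℝ (familySplitting V φ ω) (μ, 0) (0, 1) := by
  simp only [h.fderiv_familySplitting hV]
  rw [h.fderiv_complexMonodromy_apply hV, map_add, map_smul, map_smul]

theorem hasDerivAt_ofReal_prodMk (ν : ℝ) :
    HasDerivAt (fun μ : ℝ => ((μ : ℂ), (0 : ℝ))) ((1 : ℂ), (0 : ℝ)) ν :=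
  Complex.ofRealCLM.hasDerivAt.prodMk (hasDerivAt_const _ _)

theorem IsStandingWaveFamily.trace_fderiv_one_zero (h : IsStandingWaveFamily V φ ω δ)
    (hV : Continuous V) (ν : ℝ) :
    (fderiv ℝ (complexMonodromy V φ ω) (ν, 0) (1, 0)).trace =
      ((deriv (hillDiscriminant V φ ω) ν - deriv (hillDiscriminant V φ ω) (-ν) : ℝ) : ℂ) := by
  have h1 := (((traceCLM (n := 4)).restrictScalars ℝ).hasFDerivAt.comp _
    (h.hasFDerivAt_complexMonodromy hV ν)).comp_hasDerivAt ν (hasDerivAt_ofReal_prodMk ν)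
  have hd := h.differentiable_hillDiscriminant hV
  have h2 := ((hd ν).hasDerivAt.add ((hd (-ν)).hasDerivAt.scomp ν (hasDerivAt_neg ν))).ofReal_comp
  refine (h1.unique (h2.congr_of_eventuallyEq (Eventually.of_forall fun x => ?_))).trans ?_
  · exact h.trace_complexMonodromy_zero hV x
  · simp [sub_eq_add_neg]

theorem IsStandingWaveFamily.fderiv_familySplitting_one_zero (h : IsStandingWaveFamily V φ ω δ)
    (hV : Continuous V) (ν : ℝ) :
    fderiv ℝ (familySplitting V φ ω) (ν, 0) (1, 0) =
      ((slopeSum V φ ω ν / 2 : ℝ) : ℂ) • exchange := by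
  have h1 := ((h.contDiffAt_familySplitting hV ν).differentiableAt
    (by norm_num)).hasFDerivAt.comp_hasDerivAt ν (hasDerivAt_ofReal_prodMk ν)
  have hd := h.differentiable_hillDiscriminant hV
  have h2 := ((((hd ν).hasDerivAt.sub
    ((hd (-ν)).hasDerivAt.scomp ν (hasDerivAt_neg ν))).div_const 2).ofReal_comp).smul_const exchange
  refine (h1.unique (h2.congr_of_eventuallyEq (Eventually.of_forall fun x => ?_))).trans ?_
  · exact h.familySplitting_zero hV x
  · simp [slopeSum]

/-- `∂_ε Tr M` is real at real `μ`. -/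
theorem IsStandingWaveFamily.exists_trace_fderiv_zero_one (h : IsStandingWaveFamily V φ ω δ)
    (hV : Continuous V) (ν : ℝ) :
    ∃ σ : ℝ, (fderiv ℝ (complexMonodromy V φ ω) (ν, 0) (0, 1)).trace = σ := by
  have hl : HasDerivAt (fun ε : ℝ => ((ν : ℂ), ε)) ((0 : ℂ), (1 : ℝ)) 0 :=
    (hasDerivAt_const _ _).prodMk (hasDerivAt_id _)
  have h1 := (((traceCLM (n := 4)).restrictScalars ℝ).hasFDerivAt.comp _
    (h.hasFDerivAt_complexMonodromy hV ν)).comp_hasDerivAt (0 : ℝ) hl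
  refine ⟨_, deriv_eq_of_hasDerivAt_ofReal (g := fun ε => (stabilityMonodromy V φ ω ν ε).trace)
    (h1.congr_of_eventuallyEq ?_)⟩
  filter_upwards [h.eventually_abs_lt] with ε hε
  exact (h.trace_ofReal hV hε ν).symm

theorem IsStandingWaveFamily.continuous_trace (h : IsStandingWaveFamily V φ ω δ)
    (hV : Continuous V) {ε : ℝ} (hε : |ε| < δ) :
    Continuous fun μ : ℂ => (complexMonodromy V φ ω (μ, ε)).trace := by
  refine (traceCLM (n := 4)).continuous.comp (continuous_iff_continuousAt.2 fun μ => ?_)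
  obtain ⟨N, hN⟩ := h.exists_hasDerivAt_monodromy hV hε μ
  exact hN.continuousAt

/-- The spectral criterion in terms of the monodromy matrix of the family. -/
theorem IsStandingWaveFamily.mem_stabilitySpectrum (h : IsStandingWaveFamily V φ ω δ)
    (hV : Continuous V) (hper : Function.Periodic V 1) {ε : ℝ} (hε : |ε| < δ) {μ : ℂ} {K : ℝ}
    (hK : K ∈ Ioo (-2 : ℝ) 2)
    (heq : (2 * (K : ℂ) - (complexMonodromy V φ ω (μ, ε)).trace) ^ 2 =
      (familySplitting V φ ω (μ, ε) * familySplitting V φ ω (μ, ε)).trace) :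
    μ ∈ stabilitySpectrum V φ ω ε := by
  obtain ⟨U, hU⟩ := h.exists_fundamental hV (z := (μ, ε)) hε
  have hsq := h.periodic_sq hε
  refine mem_stabilitySpectrum_of_discriminant (h.continuous_potPlus hV hε)
    (h.continuous_potMinus hV hε) (fun x => ?_) (fun x => ?_) hU hK ?_
  · simp only [potPlus, hper x, hsq x]
  · simp only [potMinus, hper x, hsq x]
  · rw [hU.eq_complexMonodromy h hV hε]
    exact heq

end Bifurcation

end SidebandNLS

open SidebandNLS in
theorem mainTheorem5
    (V : ℝ → ℝ) (hVcont : Continuous V) (hVper : Function.Periodic V 1)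
    (φ : ℝ → ℝ → ℝ) (ω : ℝ → ℝ) (δ : ℝ)
    (hfam : SidebandNLS.IsStandingWaveFamily V φ ω δ)
    (μs : ℝ)
    (hdeg : SidebandNLS.hillDiscriminant V φ ω μs = SidebandNLS.hillDiscriminant V φ ω (-μs))
    (hband : SidebandNLS.hillDiscriminant V φ ω μs ∈ Set.Ioo (-2 : ℝ) 2)
    (hsign :
      (SignType.sign (deriv (SidebandNLS.hillDiscriminant V φ ω) μs) =
          SignType.sign (deriv (SidebandNLS.hillDiscriminant V φ ω) (-μs)) ∧
        0 < SidebandNLS.normalFormGamma V φ ω μs) ∨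
      (SignType.sign (deriv (SidebandNLS.hillDiscriminant V φ ω) μs) =
          -SignType.sign (deriv (SidebandNLS.hillDiscriminant V φ ω) (-μs)) ∧
        SidebandNLS.normalFormGamma V φ ω μs < 0)) :
    ∀ r : ℝ, 0 < r → ∃ ε₀ : ℝ, 0 < ε₀ ∧ ε₀ ≤ δ ∧ ∀ ε : ℝ, 0 < |ε| → |ε| < ε₀ →
      SidebandNLS.HasBandOffRealAxis
        (SidebandNLS.stabilitySpectrum V φ ω ε) (μs : ℂ) r := by
  intro r hr
  set k := hillDiscriminant V φ ω with hk
  have hk₁ : deriv k μs ≠ 0 := hfam.deriv_hillDiscriminant_ne_zero hVcont hband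
  have hk₂ : deriv k (-μs) ≠ 0 := by
    refine hfam.deriv_hillDiscriminant_ne_zero hVcont ?_
    rwa [← hk, ← hdeg]
  have hZ0 : familySplitting V φ ω (μs, 0) = 0 := by
    rw [hfam.familySplitting_zero hVcont, ← hk, hdeg]
    simp
  obtain ⟨κ, hκ⟩ := exists_discriminant_neg (k₂ := deriv k (-μs)) (β := mixedCoeff V φ ω μs)
    (γ₀ := epsSqCoeff V φ ω μs) (γ := normalFormGamma V φ ω μs) hk₁ (by
      rw [normalFormGamma, slopeSum]
      split_ifs <;> rfl) (mul_mul_pos_of_sign hk₁ hk₂ hsign)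
  obtain ⟨σ, hσ⟩ := hfam.exists_trace_fderiv_zero_one hVcont μs
  have hSd := ((traceCLM (n := 4)).restrictScalars ℝ).hasStrictFDerivAt.comp _
    ((hfam.contDiffAt_complexMonodromy hVcont μs).hasStrictFDerivAt one_ne_zero)
  have hZd := (hfam.contDiffAt_familySplitting hVcont μs).hasStrictFDerivAt one_ne_zero
  have hρ : 0 < min (2 - k μs) (k μs + 2) := lt_min (by linarith [hband.2]) (by linarith [hband.1])
  obtain ⟨ε₁, hε₁, hmain⟩ := exists_nonreal_arc (K₀ := k μs) (S₁ := deriv k μs - deriv k (-μs))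
    (σ := σ) (s₂ := (deriv k μs + deriv k (-μs)) ^ 2) hSd hZd
    (by
      refine (hfam.trace_complexMonodromy_zero hVcont μs).trans ?_
      rw [← hk, ← hdeg]
      push_cast
      ring) hZ0
    (fun m e => by
      change (fderiv ℝ (complexMonodromy V φ ω) (μs, 0) (m, e)).trace = _
      rw [hfam.fderiv_complexMonodromy_apply hVcont, Matrix.trace_add,
        Matrix.trace_smul, Matrix.trace_smul, hσ,
        hfam.trace_fderiv_one_zero hVcont, smul_eq_mul, smul_eq_mul]
      ring)
    (hfam.fderiv_familySplitting_apply hVcont μs)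
    (by
      rw [hfam.fderiv_familySplitting_one_zero hVcont, smul_mul_smul_comm, Matrix.trace_smul,
        trace_exchange_mul_self, slopeSum, smul_eq_mul]
      push_cast
      ring)
    (hfam.mixedCoeff_eq hVcont hZ0) (hfam.epsSqCoeff_eq hVcont hZ0) hκ hr hρ
  refine ⟨min ε₁ δ, lt_min hε₁ hfam.delta_pos, min_le_right _ _, fun ε hε0 hε => ?_⟩
  have hεδ : |ε| < δ := hε.trans_le (min_le_right _ _)
  obtain ⟨a, b, c, hab, hc, hcK⟩ := hmain ε hε0 (hε.trans_le (min_le_left _ _))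
  obtain ⟨a', b', ha, hab', hb, hinj⟩ := exists_injOn_subarc hab (c := c)
    (S := fun μ => (complexMonodromy V φ ω (μ, ε)).trace)
    (D := fun μ => (familySplitting V φ ω (μ, ε) * familySplitting V φ ω (μ, ε)).trace)
    ((hfam.continuous_trace hVcont hεδ).comp_continuousOn hc) fun K hK => (hcK K hK).2.2.2
  have hsub : Icc a' b' ⊆ Icc a b := Icc_subset_Icc ha hb
  refine hasBandOffRealAxis_of_subarc hab' (hc.mono hsub) hinj fun K hK => ?_
  obtain ⟨h1, h2, h3, h4⟩ := hcK K (hsub hK)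
  have h5 := abs_lt.1 (h1.trans_le (min_le_left _ _))
  have h6 := abs_lt.1 (h1.trans_le (min_le_right _ _))
  exact ⟨hfam.mem_stabilitySpectrum hVcont hVper hεδ
    ⟨by linarith [h6.1], by linarith [h5.2]⟩ h4, h2, h3⟩
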